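/- **Setting.** Let $F=f+g$ on $\mathbb R^n$ with $f,g:\mathbb R^n\to\mathbb R\cup\{\infty\}$. *Assumption 1.* $f$ is finite and twice differentiable on an open set $\mathcal O\supset\operatorname{dom}g$; $\nabla f$ is Lipschitz on $\mathcal O$ with constant $L>0$ and $\nabla^2 f$ is Lipschitz on $\mathcal O$; $g$ is proper and lsc; $\inf F>-\infty$. *Assumption 2.* $g$ is prox-regular at every point of $\operatorname{dom}g$ (for every limiting subgradient) and prox-bounded with threshold $\gamma_g\ge 1/L$. For $\gamma>0$ let $\mathcal P_\gamma g(x)=\arg\min_z\{\frac1{2\gamma}\|z-x\|^2+g(z)\}$, $\mathcal T_\gamma(x)=\mathcal P_\gamma g(x-\gamma\nabla f(x))$, $\mathcal R_\gamma(x)=\gamma^{-1}(x-\mathcal T_\gamma(x))$, $Q_\gamma(x)=I-\gamma\nabla^2 f(x)$ and $$F_\gamma(x)=\inf_z\Big\{f(x)+\langle\nabla f(x),z-x\rangle+\tfrac1{2\gamma}\|z-x\|^2+g(z)\Big\},\qquad x\in\mathcal O.$$ Where $\mathcal P_\gamma g$ is single-valued and Lipschitz around $x-\gamma\nabla f(x)$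 and $Q_\gamma(x)$ is nonsingular, let $\partial^2F_\gamma(x)=\{\gamma^{-1}Q_\gamma(x)(I-WQ_\gamma(x)) : W\in\partial_C\mathcal P_\gamma g(x-\gamma\nabla f(x))\}$, where $\partial_C$ is the Clarke generalized Jacobian. **Algorithm.** Let $\beta\in(0,1)$, $\alpha>0$, $\overline\gamma\ge\frac1{L+\alpha}$, $\widetilde L=L+2\alpha$, $\tau\in(0,1)$, $\varrho\in(0,1-\tau)$, $0<\underline\varsigma<\overline\varsigma$, $0<\underline\sigma<\overline\sigma$, $y^0\in\mathcal O$. For $k=0,1,\dots$: (1) choose $\gamma_k\in[\frac1{L+\alpha},\overline\gamma]$ and $x^k\in\mathcal T_{\gamma_k}(y^k)$ with $F(x^k)\le F_{\gamma_k}(y^k)-\frac\alpha2\|x^k-y^k\|^2$; stop if $x^k=y^k$. (2a) $\widetilde\gamma_k=\widetilde L^{-1}\beta^{m_k}$, with $m_k$ the least $m\ge0$ such that $\mathcal T_{\widetilde L^{-1}\beta^m}$ is single-valued and Lipschitz around $x^k$. (2b) $\mu_k=\|\mathcal R_{\widetilde\gamma_k}(x^k)\|^\tau$; choose $H_k\in\partial^2F_{\widetilde\gamma_k}(x^k)$,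 $\sigma_k\in[\underline\sigma,\overline\sigma]$, $\varsigma_k\in[\underline\varsigma,\overline\varsigma]$, and let $d^k$ be a global minimizer of $\frac12d^\top(H_k+\mu_k\sigma_kI)d+(Q_{\widetilde\gamma_k}(x^k)\mathcal R_{\widetilde\gamma_k}(x^k))^\top d$ subject to $\|d\|\le\varsigma_k\|\mathcal R_{\widetilde\gamma_k}(x^k)\|^\varrho$. (2c) $y^{k+1}=\beta^{l_k}(x^k+d^k)+(1-\beta^{l_k})\mathcal T_{\widetilde\gamma_k}(x^k)$, with $l_k$ the least $l\ge0$ for which the point $y=\beta^{l}(x^k+d^k)+(1-\beta^{l})\mathcal T_{\widetilde\gamma_k}(x^k)$ lies in $\mathcal O$ and satisfies $F_{\widetilde\gamma_k}(y)\le F_{\widetilde\gamma_k}(x^k)-\frac{\widetilde\gamma_k-\widetilde\gamma_k^2L}{4}\|\mathcal R_{\widetilde\gamma_k}(x^k)\|^2$. Suppose that the algorithm does not stop, so that infinite sequences are generated. Write $F_*,\mathcal R_*$ for $F_{\widetilde L^{-1}},\mathcal R_{\widetilde L^{-1}}$ and $\mathcal X^*=\{x: 0\in\mathcal R_*(x)\}$;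 $\mathbb B(x,r)$ is the closed ball. *Assumption 3.* $\{x^k\}$ is bounded. *Assumption 4.* (i) $x^k\to x^*\in\mathcal X^*$, a local minimum of $F$. (ii) There are $\varepsilon,\kappa>0$ with $\operatorname{dist}(x,\mathcal X^*)\le\kappa\operatorname{dist}(0,\mathcal R_*(x))$ for all $x\in\mathbb B(x^*,\varepsilon)\cap\mathcal O$. (iii) There is $\overline\varepsilon\in(0,\varepsilon)$ with $F_*(x)=F_*(x^*)$ for all $x\in\mathbb B(x^*,\overline\varepsilon)\cap\mathcal X^*$. *Conditions.* (C1) There are $\varepsilon_1,\kappa_1>0$, $\rho_1\in(\tau,1]$ such that for all $x\in\mathbb B(x^*,\varepsilon_1)\cap\mathcal O$, every projection $\overline x$ of $x$ onto $\mathcal X^*$ and every $H\in\partial^2F_*(x)$ there is $\overline H\in\partial^2F_*(\overline x)$ with $\|H-\overline H\|_2\le\kappa_1\|x-\overline x\|^{\rho_1}$. (C2) There is $\delta>0$ such that $H\succeq0$ for all $H\in\partial^2F_*(x)$, $x\in\mathcal X^*\cap\mathbb B(x^*,\delta)$. (C3) There are $\varepsilon_2,\kappa_2>0$, $\rho_2\in[\tau,1]$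 such that $\mathcal R_*$ is single-valued and locally Lipschitz at every point of $\mathbb B(x^*,\varepsilon_2)\cap\mathcal O$ and $\|\mathcal R_*(y)-\mathcal R_*(x)-J(y-x)\|\le\kappa_2\|y-x\|^{1+\rho_2}$ for all $x,y\in\mathbb B(x^*,\varepsilon_2)\cap\mathcal O$ and $J\in\partial_C\mathcal R_*(x)$. **Theorem.** Under Assumptions 1–4 and (C1)–(C3) there are $\widetilde c,\widetilde c_2>0$ and $\overline k$ such that for all $k>\overline k$ the distances $\operatorname{dist}(x^k,\mathcal X^*)$ and $\operatorname{dist}(y^k,\mathcal X^*)$ are positive, $\operatorname{dist}(x^k+d^k,\mathcal X^*)\le\widetilde c\,\operatorname{dist}(x^k,\mathcal X^*)^{1+\tau}$, $l_k=0$ (the unit step is accepted), and $\operatorname{dist}(y^{k+1},\mathcal X^*)\le\widetilde c_2\operatorname{dist}(y^k,\mathcal X^*)^{1+\tau}$. Consequently $$\lim_{k\to\infty}\frac{\operatorname{dist}(x^k+d^k,\mathcal X^*)}{\operatorname{dist}(x^k,\mathcal X^*)}=0$$ (the $d^k$ are superlinear directions), $\operatorname{dist}(y^k,\mathcal X^*)\to0$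 and $\operatorname{dist}(y^{k+1},\mathcal X^*)/\operatorname{dist}(y^k,\mathcal X^*)\to0$. -/

import Mathlib

open Filter Topology

noncomputable section

namespace PGSSN

/-- `ℝⁿ` with the Euclidean norm. -/
abbrev E (n : ℕ) : Type := EuclideanSpace ℝ (Fin n)

section VariationalAnalysis

variable {n : ℕ}

/-- Effective domain of an extended real-valued function. -/
def dom (h : E n → EReal) : Set (E n) := {x | h x < ⊤}

/-- Proper: never `-∞`, and not identically `+∞`. -/
def Proper (h : E n → EReal) : Prop := (∀ x, h x ≠ ⊥) ∧ ∃ x, h x ≠ ⊤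

/-- The function `z ↦ (2γ)⁻¹ ‖z - x‖² + h z`. -/
def proxObj (γ : ℝ) (h : E n → EReal) (x z : E n) : EReal :=
  (((2 * γ)⁻¹ * ‖z - x‖ ^ 2 : ℝ) : EReal) + h z

/-- The (set-valued) proximal mapping `P_γ h`. -/
def prox (γ : ℝ) (h : E n → EReal) (x : E n) : Set (E n) :=
  {z | ∀ w, proxObj γ h x z ≤ proxObj γ h x w}

/-- The Moreau envelope `e_γ h`. -/
def moreau (γ : ℝ) (h : E n → EReal) (x : E n) : EReal := ⨅ z, proxObj γ h x z

/-- The parameters `γ > 0` for which the Moreau envelope is `> -∞` at some point. -/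
def proxBoundedSet (h : E n → EReal) : Set ℝ := {γ | 0 < γ ∧ ∃ x, ⊥ < moreau γ h x}

def ProxBounded (h : E n → EReal) : Prop := (proxBoundedSet h).Nonempty

/-- Threshold of prox-boundedness (it may be `+∞`). -/
def proxThreshold (h : E n → EReal) : EReal :=
  sSup ((fun γ : ℝ => (γ : EReal)) '' proxBoundedSet h)

/-- Regular (Fréchet) subdifferential at a point where `h` is finite. -/
def regSubdiff (h : E n → EReal) (x : E n) : Set (E n) :=
  {v | h x ≠ ⊥ ∧ h x ≠ ⊤ ∧ ∀ ε : ℝ, 0 < ε →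
    ∀ᶠ z in 𝓝 x, h x + ((inner ℝ v (z - x) - ε * ‖z - x‖ : ℝ) : EReal) ≤ h z}

/-- Limiting (Mordukhovich) subdifferential at a point where `h` is finite. -/
def limSubdiff (h : E n → EReal) (x : E n) : Set (E n) :=
  {v | h x ≠ ⊥ ∧ h x ≠ ⊤ ∧ ∃ (u w : ℕ → E n),
    Tendsto u atTop (𝓝 x) ∧ Tendsto (fun j => h (u j)) atTop (𝓝 (h x)) ∧
    (∀ j, w j ∈ regSubdiff h (u j)) ∧ Tendsto w atTop (𝓝 v)}

/-- Local lower semicontinuity at a point where `h` is finite. -/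
def LocallyLsc (h : E n → EReal) (x₀ : E n) : Prop :=
  ∃ ε : ℝ, 0 < ε ∧ ∀ a : ℝ, (a : EReal) ≤ h x₀ + (ε : EReal) →
    IsClosed {x | x ∈ Metric.closedBall x₀ ε ∧ h x ≤ (a : EReal)}

/-- Prox-regularity of `h` at `x₀` for `v₀`. -/
def ProxRegularAtFor (h : E n → EReal) (x₀ v₀ : E n) : Prop :=
  LocallyLsc h x₀ ∧
  ∃ ρ ε : ℝ, 0 ≤ ρ ∧ 0 < ε ∧
    ∀ x v, v ∈ limSubdiff h x → ‖x - x₀‖ < ε → ‖v - v₀‖ < ε → h x < h x₀ + (ε : EReal) →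
      ∀ x', ‖x' - x₀‖ ≤ ε →
        h x + ((inner ℝ v (x' - x) - ρ / 2 * ‖x' - x‖ ^ 2 : ℝ) : EReal) ≤ h x'

/-- Prox-regularity of `h` at `x₀`, i.e. for every limiting subgradient at `x₀`. -/
def ProxRegularAt (h : E n → EReal) (x₀ : E n) : Prop :=
  ∀ v ∈ limSubdiff h x₀, ProxRegularAtFor h x₀ v

/-- The multifunction `S` is single-valued and Lipschitz continuous on a neighbourhood of `x`. -/
def LocSingleLip (S : E n → Set (E n)) (x : E n) : Prop :=
  ∃ r K : ℝ, 0 < r ∧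
    (∀ u ∈ Metric.ball x r, ∃! z, z ∈ S u) ∧
    ∀ u ∈ Metric.ball x r, ∀ v ∈ Metric.ball x r, ∀ z ∈ S u, ∀ w ∈ S v,
      ‖z - w‖ ≤ K * ‖u - v‖

/-- A multifunction read as a function: where `S` is single-valued this is its value.
It is only used at points around which `S` is single-valued. -/
def val (S : E n → Set (E n)) (x : E n) : E n :=
  open Classical in if h : (S x).Nonempty then h.some else 0

/-- `B`-subdifferential: limits of Jacobians at nearby points of differentiability. -/
def bSubdiff (H : E n → E n) (x : E n) : Set (E n →L[ℝ] E n) :=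
  {V | ∃ (u : ℕ → E n) (D : ℕ → (E n →L[ℝ] E n)),
    Tendsto u atTop (𝓝 x) ∧ (∀ j, HasFDerivAt H (D j) (u j)) ∧ Tendsto D atTop (𝓝 V)}

/-- Clarke generalized Jacobian. -/
def clarke (H : E n → E n) (x : E n) : Set (E n →L[ℝ] E n) := convexHull ℝ (bSubdiff H x)

/-- The set of projections of `x` onto `D`. -/
def projSet (D : Set (E n)) (x : E n) : Set (E n) := {z | z ∈ D ∧ ‖x - z‖ = Metric.infDist x D}

end VariationalAnalysis

section Composite

variable {n : ℕ}

/-- The objective `F = f + g`. -/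
def objective (f g : E n → EReal) (x : E n) : EReal := f x + g x

/-- `∇f`; used only on the open set where `f` is finite and differentiable. -/
def grad (f : E n → EReal) (x : E n) : E n := gradient (fun u => (f u).toReal) x

/-- `∇²f`, as a linear operator. -/
def hess (f : E n → EReal) (x : E n) : E n →L[ℝ] E n := fderiv ℝ (grad f) x

/-- `T_γ(x) = P_γ g (x - γ ∇f(x))`. -/
def fbStep (f g : E n → EReal) (γ : ℝ) (x : E n) : Set (E n) := prox γ g (x - γ • grad f x)

/-- `R_γ(x) = γ⁻¹ (x - T_γ(x))`. -/
def residual (f g : E n → EReal) (γ : ℝ) (x : E n) : Set (E n) :=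
  (fun z => γ⁻¹ • (x - z)) '' fbStep f g γ x

/-- Forward-backward envelope `F_γ`. -/
def fbe (f g : E n → EReal) (γ : ℝ) (x : E n) : EReal :=
  ⨅ z, ((((f x).toReal + inner ℝ (grad f x) (z - x) + (2 * γ)⁻¹ * ‖z - x‖ ^ 2 : ℝ) : EReal) + g z)

/-- `Q_γ(x) = I - γ ∇²f(x)`. -/
def Q (f : E n → EReal) (γ : ℝ) (x : E n) : E n →L[ℝ] E n :=
  ContinuousLinearMap.id ℝ (E n) - γ • hess f x

/-- `∂²F_γ(x) = {γ⁻¹ Q_γ(x) (I - W Q_γ(x)) | W ∈ ∂_C P_γ g (x - γ ∇f(x))}`, defined where `P_γ g`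
is single-valued and Lipschitz around `x - γ ∇f(x)` and `Q_γ(x)` is nonsingular
(empty elsewhere). -/
def genHess (f g : E n → EReal) (γ : ℝ) (x : E n) : Set (E n →L[ℝ] E n) :=
  {H | LocSingleLip (prox γ g) (x - γ • grad f x) ∧ IsUnit (Q f γ x) ∧
    ∃ W ∈ clarke (val (prox γ g)) (x - γ • grad f x),
      H = γ⁻¹ • (Q f γ x ∘L (ContinuousLinearMap.id ℝ (E n) - W ∘L Q f γ x))}

/-- The set `{x | 0 ∈ R_γ(x)}`. -/
def zeroSet (f g : E n → EReal) (γ : ℝ) : Set (E n) := {x | (0 : E n) ∈ residual f g γ x}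

/-- Standing assumptions on `f` and `g`: `f` is finite and twice differentiable on the open set
`O ⊇ dom g`, with `∇f` `L`-Lipschitz and `∇²f` Lipschitz on `O`; `g` is proper and lsc;
`f + g` is bounded below. -/
structure BasicAssumptions (f g : E n → EReal) (O : Set (E n)) (L : ℝ) : Prop where
  isOpen : IsOpen O
  dom_subset : dom g ⊆ O
  f_ne_bot : ∀ x, f x ≠ ⊥
  f_ne_top : ∀ x ∈ O, f x ≠ ⊤
  f_diff : ∀ x ∈ O, DifferentiableAt ℝ (fun u => (f u).toReal) x
  grad_diff : ∀ x ∈ O, DifferentiableAt ℝ (grad f) x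
  L_pos : 0 < L
  grad_lip : ∀ x ∈ O, ∀ y ∈ O, ‖grad f x - grad f y‖ ≤ L * ‖x - y‖
  hess_lip : ∃ K : ℝ, ∀ x ∈ O, ∀ y ∈ O, ‖hess f x - hess f y‖ ≤ K * ‖x - y‖
  g_proper : Proper g
  g_lsc : LowerSemicontinuous g
  bddBelow : ∃ b : ℝ, ∀ x, (b : EReal) ≤ objective f g x

/-- `g` is prox-regular on `dom g` and prox-bounded with threshold at least `1/L`. -/
structure ProxAssumptions (g : E n → EReal) (L : ℝ) : Prop where
  proxRegular : ∀ x ∈ dom g, ProxRegularAt g x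
  proxBounded : ProxBounded g
  threshold : ((1 / L : ℝ) : EReal) ≤ proxThreshold g

/-- The real parameters of the algorithm. -/
structure Params where
  β : ℝ
  α : ℝ
  γbar : ℝ
  τ : ℝ
  ϱ : ℝ
  ςlo : ℝ
  ςhi : ℝ
  σlo : ℝ
  σhi : ℝ

/-- Admissible parameters. -/
structure Params.Admissible (p : Params) (L : ℝ) : Prop where
  β_pos : 0 < p.β
  β_lt : p.β < 1
  α_pos : 0 < p.α
  γbar_ge : 1 / (L + p.α) ≤ p.γbar
  τ_pos : 0 < p.τ
  τ_lt : p.τ < 1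
  ϱ_pos : 0 < p.ϱ
  ϱ_lt : p.ϱ < 1 - p.τ
  ςlo_pos : 0 < p.ςlo
  ςlo_lt : p.ςlo < p.ςhi
  σlo_pos : 0 < p.σlo
  σlo_lt : p.σlo < p.σhi

/-- `L̃⁻¹ = (L + 2α)⁻¹`. -/
def Params.γstar (p : Params) (L : ℝ) : ℝ := (L + 2 * p.α)⁻¹

/-- All quantities produced along a run of the algorithm. -/
structure Iterates (n : ℕ) where
  x : ℕ → E n
  y : ℕ → E n
  d : ℕ → E n
  γ : ℕ → ℝ
  m : ℕ → ℕ
  H : ℕ → (E n →L[ℝ] E n)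
  σ : ℕ → ℝ
  ς : ℕ → ℝ
  l : ℕ → ℕ

/-- `γ̃_k = L̃⁻¹ β^{m_k}`. -/
def Iterates.γt (it : Iterates n) (p : Params) (L : ℝ) (k : ℕ) : ℝ := p.γstar L * p.β ^ it.m k

/-- `R_{γ̃_k}(x^k)`, a vector since `R_{γ̃_k}` is single-valued around `x^k`. -/
def Iterates.res (it : Iterates n) (f g : E n → EReal) (p : Params) (L : ℝ) (k : ℕ) : E n :=
  val (residual f g (it.γt p L k)) (it.x k)

/-- The quadratic model `d ↦ ½ ⟨d, (H + μσ I) d⟩ + ⟨q, d⟩`. -/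
def quadModel (H : E n →L[ℝ] E n) (μσ : ℝ) (q d : E n) : ℝ :=
  1 / 2 * inner ℝ d (H d + μσ • d) + inner ℝ q d

/-- The trial point `β^l (x^k + d^k) + (1 - β^l) T_{γ̃_k}(x^k)`. -/
def Iterates.trial (it : Iterates n) (f g : E n → EReal) (p : Params) (L : ℝ) (k l : ℕ) : E n :=
  (p.β ^ l) • (it.x k + it.d k) + (1 - p.β ^ l) • val (fbStep f g (it.γt p L k)) (it.x k)

/-- An infinite run of the hybrid proximal-gradient / semismooth Newton method with stopping
tolerance `0` (so `x^k ≠ y^k` for all `k`). The envelope is only defined on `O`, so that a trial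
point can be accepted only if it lies in `O`. -/
structure IsRun (f g : E n → EReal) (O : Set (E n)) (L : ℝ) (p : Params) (it : Iterates n) :
    Prop where
  y_zero : it.y 0 ∈ O
  γ_mem : ∀ k, it.γ k ∈ Set.Icc (1 / (L + p.α)) p.γbar
  x_mem : ∀ k, it.x k ∈ fbStep f g (it.γ k) (it.y k)
  x_descent : ∀ k, objective f g (it.x k) ≤
    fbe f g (it.γ k) (it.y k) - ((p.α / 2 * ‖it.x k - it.y k‖ ^ 2 : ℝ) : EReal)
  not_stop : ∀ k, it.x k ≠ it.y k
  m_least : ∀ k, IsLeast {m : ℕ | LocSingleLip (fbStep f g (p.γstar L * p.β ^ m)) (it.x k)} (it.m k)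
  H_mem : ∀ k, it.H k ∈ genHess f g (it.γt p L k) (it.x k)
  σ_mem : ∀ k, it.σ k ∈ Set.Icc p.σlo p.σhi
  ς_mem : ∀ k, it.ς k ∈ Set.Icc p.ςlo p.ςhi
  d_mem : ∀ k, ‖it.d k‖ ≤ it.ς k * ‖it.res f g p L k‖ ^ p.ϱ
  d_min : ∀ k, ∀ d : E n, ‖d‖ ≤ it.ς k * ‖it.res f g p L k‖ ^ p.ϱ →
    quadModel (it.H k) (‖it.res f g p L k‖ ^ p.τ * it.σ k)
        (Q f (it.γt p L k) (it.x k) (it.res f g p L k)) (it.d k) ≤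
      quadModel (it.H k) (‖it.res f g p L k‖ ^ p.τ * it.σ k)
        (Q f (it.γt p L k) (it.x k) (it.res f g p L k)) d
  l_least : ∀ k, IsLeast {l : ℕ | it.trial f g p L k l ∈ O ∧
    fbe f g (it.γt p L k) (it.trial f g p L k l) ≤
      fbe f g (it.γt p L k) (it.x k) -
        (((it.γt p L k - it.γt p L k ^ 2 * L) / 4 * ‖it.res f g p L k‖ ^ 2 : ℝ) : EReal)} (it.l k)
  y_succ : ∀ k, it.y (k + 1) = it.trial f g p L k (it.l k)

/-- The iterates `x^k` converge to `xs ∈ X*`, a local minimum of `F`; `R_*` is metrically subregular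
at `xs` for `0`; and `F_*` is constant on `X*` near `xs`. -/
structure LocalAssumptions (f g : E n → EReal) (O : Set (E n)) (γs : ℝ) (x : ℕ → E n) (xs : E n) :
    Prop where
  tendsto : Tendsto x atTop (𝓝 xs)
  mem : xs ∈ zeroSet f g γs
  localMin : IsLocalMin (objective f g) xs
  subregular : ∃ ε κ : ℝ, 0 < ε ∧ 0 < κ ∧
    (∀ u ∈ Metric.closedBall xs ε ∩ O, Metric.infEDist u (zeroSet f g γs) ≤
      ENNReal.ofReal κ * Metric.infEDist 0 (residual f g γs u)) ∧
    ∃ ε' : ℝ, 0 < ε' ∧ ε' < ε ∧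
      ∀ u ∈ Metric.closedBall xs ε' ∩ zeroSet f g γs, fbe f g γs u = fbe f g γs xs

/-- (C1): Hölder calmness of `∂²F_*` relative to projections onto `X*`. -/
def CondC1 (f g : E n → EReal) (O : Set (E n)) (γs τ : ℝ) (xs : E n) : Prop :=
  ∃ ε₁ κ₁ ρ₁ : ℝ, 0 < ε₁ ∧ 0 < κ₁ ∧ τ < ρ₁ ∧ ρ₁ ≤ 1 ∧
    ∀ u ∈ Metric.closedBall xs ε₁ ∩ O, ∀ ub ∈ projSet (zeroSet f g γs) u,
      ∀ H ∈ genHess f g γs u, ∃ Hb ∈ genHess f g γs ub, ‖H - Hb‖ ≤ κ₁ * ‖u - ub‖ ^ ρ₁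

/-- (C2): positive semidefiniteness of `∂²F_*` on `X*` near `xs`. -/
def CondC2 (f g : E n → EReal) (γs : ℝ) (xs : E n) : Prop :=
  ∃ δ : ℝ, 0 < δ ∧ ∀ u ∈ zeroSet f g γs ∩ Metric.closedBall xs δ, ∀ H ∈ genHess f g γs u,
    ∀ v : E n, 0 ≤ inner ℝ v (H v)

/-- (C3): uniform semismoothness of `R_*` of order `ρ₂` near `xs`. The Clarke Jacobian is a notion
for locally Lipschitz (single-valued) maps, which is part of the condition. -/
def CondC3 (f g : E n → EReal) (O : Set (E n)) (γs τ : ℝ) (xs : E n) : Prop :=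
  ∃ ε₂ κ₂ ρ₂ : ℝ, 0 < ε₂ ∧ 0 < κ₂ ∧ τ ≤ ρ₂ ∧ ρ₂ ≤ 1 ∧
    ∀ u ∈ Metric.closedBall xs ε₂ ∩ O, LocSingleLip (residual f g γs) u ∧
      ∀ w ∈ Metric.closedBall xs ε₂ ∩ O, ∀ J ∈ clarke (val (residual f g γs)) u,
        ‖val (residual f g γs) w - val (residual f g γs) u - J (w - u)‖ ≤ κ₂ * ‖w - u‖ ^ (1 + ρ₂)

end Composite

end PGSSN

end

/-! Write δ for the distance of a point u near `xs` to X*. By (C3) the residual R is single-valued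
and Lipschitz near `xs`, so eventually the initial proximal parameter is kept. Lipschitz continuity
together with the error bound makes ‖R(u)‖ comparable to δ.

Direction (`newton_step`, `newton_direction`). Each generalized Hessian is symmetric
(`genHess_symm`) and factors as H = Q J with J in the Clarke Jacobian of R
(`exists_clarke_residual_of_mem_genHess`). By (C1) and (C2) the negative part of H is O(δ^ρ₁), and
since ρ₁ > τ it is dominated by the regularization a, which is of order δ^τ; so H + aI is at least
(a/2)I. Semismoothness at the projection of u onto X* says that the displacement v to that
projection solves R + Jv = 0 up to O(δ^(1+τ)). Comparison with v shows that the regularized Newton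
step has length O(δ). The trust radius is of order at least δ^ϱ with ϱ < 1, so the constraint does
not matter and Q(R + Jd) = -a d = O(δ^(1+τ)). As γL < 1, Q can be inverted with a uniform bound.
Semismoothness then gives R(u + d) = O(δ^(1+τ)), and the error bound turns this into a distance.

Unit step (`eventually_sufficient_decrease`). Let Fs be the common value of the envelope on X* near
`xs`. The envelope at w is at most Fs + O(dist(w, X*)²), which is Fs + O(δ^(2+2τ)) at w = u + d. At
u it is at least Fs plus twice the required decrease, which is of order δ².

Rate for y. Local minimality and the descent test give Fs + (α/2)‖x^k - y^k‖² ≤ F_*(y^k) ≤ Fs +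
O(dist(y^k, X*)²). Hence dist(x^k, X*) = O(dist(y^k, X*)), and the rate passes from x to y. The same
inequality with x^k ≠ y^k keeps both sequences off X*. -/

noncomputable section

namespace PGSSN

variable {n : ℕ}

/-! ### Single-valued multifunctions read as functions. -/

section SingleValued

theorem val_mem {S : E n → Set (E n)} {u : E n} (h : ∃! z, z ∈ S u) : val S u ∈ S u := by
  have h' : (S u).Nonempty := h.exists
  rw [val, dif_pos h']
  exact h'.some_mem

theorem val_eq_of_mem {S : E n → Set (E n)} {u z : E n} (h : ∃! z, z ∈ S u) (hz : z ∈ S u) :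
    val S u = z :=
  h.unique (val_mem h) hz

theorem eq_singleton_val {S : E n → Set (E n)} {u : E n} (h : ∃! z, z ∈ S u) : S u = {val S u} :=
  Set.eq_singleton_iff_unique_mem.2 ⟨val_mem h, fun _ hz => (val_eq_of_mem h hz).symm⟩

theorem existsUnique_residual_iff (f g : E n → EReal) {γ : ℝ} (hγ : 0 < γ) (u : E n) :
    (∃! z, z ∈ residual f g γ u) ↔ ∃! z, z ∈ fbStep f g γ u := by
  constructor
  · rintro ⟨_, ⟨z, hz, rfl⟩, hu⟩
    refine ⟨z, hz, fun w hw => ?_⟩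
    have h1 : γ⁻¹ • (u - w) = γ⁻¹ • (u - z) := hu _ ⟨w, hw, rfl⟩
    have h2 := smul_right_injective _ (inv_ne_zero hγ.ne') h1
    exact sub_right_injective h2
  · rintro ⟨z, hz, hu⟩
    refine ⟨_, ⟨z, hz, rfl⟩, ?_⟩
    rintro _ ⟨w, hw, rfl⟩
    rw [hu w hw]

theorem val_residual {f g : E n → EReal} {γ : ℝ} {u : E n} (h : ∃! z, z ∈ fbStep f g γ u) :
    val (residual f g γ) u = γ⁻¹ • (u - val (fbStep f g γ) u) := by
  refine val_eq_of_mem ?_ ⟨_, val_mem h, rfl⟩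
  obtain ⟨z, hz, hu⟩ := h
  refine ⟨_, ⟨z, hz, rfl⟩, ?_⟩
  rintro _ ⟨w, hw, rfl⟩
  rw [hu w hw]

theorem LocSingleLip.fbStep_of_residual {f g : E n → EReal} {γ : ℝ} (hγ : 0 < γ) {x : E n}
    (h : LocSingleLip (residual f g γ) x) : LocSingleLip (fbStep f g γ) x := by
  obtain ⟨r, K, hr, hu, hK⟩ := h
  refine ⟨r, 1 + γ * K, hr, fun u hur => (existsUnique_residual_iff f g hγ u).1 (hu u hur), ?_⟩
  intro u hur v hvr z hz w hw
  have h1 := hK u hur v hvr _ ⟨z, hz, rfl⟩ _ ⟨w, hw, rfl⟩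
  have h2 : z - w = (u - v) - γ • (γ⁻¹ • (u - z) - γ⁻¹ • (v - w)) := by
    rw [← smul_sub, smul_smul, mul_inv_cancel₀ hγ.ne', one_smul]; abel
  rw [h2]
  calc _ ≤ ‖u - v‖ + ‖γ • (γ⁻¹ • (u - z) - γ⁻¹ • (v - w))‖ := norm_sub_le _ _
    _ ≤ ‖u - v‖ + γ * (K * ‖u - v‖) := by
      rw [norm_smul, Real.norm_of_nonneg hγ.le]; gcongr
    _ = _ := by ring

end SingleValued

/-! ### Gradient, Hessian and the forward map. -/

section Smooth

/-- If `G` is the gradient of a function near `x`, then its derivative at `x` is symmetric. -/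
theorem inner_deriv_symm_of_hasGradientAt {φ : E n → ℝ} {G : E n → E n} {A : E n →L[ℝ] E n}
    {x : E n} (hφ : ∀ᶠ y in 𝓝 x, HasGradientAt φ (G y) y) (hG : HasFDerivAt G A x) (v w : E n) :
    inner ℝ (A v) w = inner ℝ v (A w) := by
  have h1 : HasFDerivAt (fun y => innerSL ℝ (G y)) ((innerSL ℝ).comp A) x :=
    (innerSL ℝ (E := E n)).hasFDerivAt.comp x hG
  have h2 : ∀ᶠ y in 𝓝 x, HasFDerivAt φ (innerSL ℝ (G y)) y := by
    filter_upwards [hφ] with y hy using hy.hasFDerivAt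
  have h3 := second_derivative_symmetric_of_eventually h2 h1 v w
  simp only [ContinuousLinearMap.comp_apply, innerSL_apply_apply] at h3
  rw [h3, real_inner_comm]

theorem quadratic_bound_of_lipschitz_gradient {φ : E n → ℝ} {G : E n → E n} {L : ℝ}
    {B : Set (E n)} (hB : Convex ℝ B) (hφ : ∀ y ∈ B, HasGradientAt φ (G y) y)
    (hL : ∀ u ∈ B, ∀ v ∈ B, ‖G u - G v‖ ≤ L * ‖u - v‖) {x z : E n} (hx : x ∈ B) (hz : z ∈ B) :
    |φ z - φ x - inner ℝ (G x) (z - x)| ≤ L / 2 * ‖z - x‖ ^ 2 := by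
  have hmem : ∀ t ∈ Set.Icc (0 : ℝ) 1, x + t • (z - x) ∈ B := fun t ht =>
    hB.add_smul_sub_mem hx hz ht
  have hd : ∀ t ∈ Set.Icc (0 : ℝ) 1, HasDerivAt (fun t : ℝ => φ (x + t • (z - x)))
      (inner ℝ (G (x + t • (z - x))) (z - x)) t := by
    intro t ht
    have h1 : HasDerivAt (fun t : ℝ => x + t • (z - x)) (z - x) t := by
      simpa using ((hasDerivAt_id t).smul_const (z - x)).const_add x
    exact (hφ _ (hmem t ht)).hasFDerivAt.comp_hasDerivAt t h1
  have hin : ∀ t ∈ Set.Icc (0 : ℝ) 1,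
      |inner ℝ (G (x + t • (z - x))) (z - x) - inner ℝ (G x) (z - x)| ≤ L * t * ‖z - x‖ ^ 2 := by
    intro t ht
    rw [← inner_sub_left]
    refine (abs_real_inner_le_norm _ _).trans ?_
    have h1 := hL _ (hmem t ht) _ hx
    rw [add_sub_cancel_left, norm_smul, Real.norm_of_nonneg ht.1] at h1
    calc _ ≤ L * (t * ‖z - x‖) * ‖z - x‖ := by gcongr
      _ = _ := by ring
  -- The sign s = ±1 treats both one-sided bounds at once: the signed remainder minus its quadratic
  -- bound is antitone along the segment.
  have key : ∀ s : ℝ, |s| = 1 →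
      s * (φ z - φ x - inner ℝ (G x) (z - x)) ≤ L / 2 * ‖z - x‖ ^ 2 := by
    intro s hs
    set h : ℝ → ℝ := fun t => s * (φ (x + t • (z - x)) - t * inner ℝ (G x) (z - x))
      - L / 2 * t ^ 2 * ‖z - x‖ ^ 2 with hh
    have hdh : ∀ t ∈ Set.Icc (0 : ℝ) 1, HasDerivAt h
        (s * (inner ℝ (G (x + t • (z - x))) (z - x) - inner ℝ (G x) (z - x))
          - L * t * ‖z - x‖ ^ 2) t := by
      intro t ht
      have h1 := ((hd t ht).sub ((hasDerivAt_id t).mul_const (inner ℝ (G x) (z - x)))).const_mul s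
      have h2 := (((hasDerivAt_id t).pow 2).const_mul (L / 2)).mul_const (‖z - x‖ ^ 2)
      have h3 := h1.sub h2
      simp only [id] at h3
      refine h3.congr_deriv ?_
      push_cast
      ring
    have hanti : AntitoneOn h (Set.Icc 0 1) := by
      refine antitoneOn_of_deriv_nonpos (convex_Icc 0 1)
        (fun t ht => (hdh t ht).continuousAt.continuousWithinAt)
        (fun t ht => (hdh t (interior_subset ht)).differentiableAt.differentiableWithinAt) ?_
      intro t ht
      rw [(hdh t (interior_subset ht)).deriv, sub_nonpos]
      refine (le_abs_self _).trans ?_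
      rw [abs_mul, hs, one_mul]
      exact hin t (interior_subset ht)
    have h01 := hanti (Set.left_mem_Icc.2 zero_le_one) (Set.right_mem_Icc.2 zero_le_one) zero_le_one
    simp only [hh, one_smul, zero_smul, add_zero, add_sub_cancel] at h01
    linarith
  rw [abs_le]
  have := key 1 (by simp)
  have := key (-1) (by simp)
  constructor <;> linarith

namespace BasicAssumptions

variable {f g : E n → EReal} {O : Set (E n)} {L : ℝ}

theorem hasGradientAt (h : BasicAssumptions f g O L) {x : E n} (hx : x ∈ O) :
    HasGradientAt (fun u => (f u).toReal) (grad f x) x :=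
  (h.f_diff x hx).hasGradientAt

theorem hess_symm (h : BasicAssumptions f g O L) {x : E n} (hx : x ∈ O) (v w : E n) :
    inner ℝ (hess f x v) w = inner ℝ v (hess f x w) :=
  inner_deriv_symm_of_hasGradientAt
    (by filter_upwards [h.isOpen.mem_nhds hx] with y hy using h.hasGradientAt hy)
    (h.grad_diff x hx).hasFDerivAt v w

theorem norm_hess_le (h : BasicAssumptions f g O L) {x : E n} (hx : x ∈ O) : ‖hess f x‖ ≤ L := by
  refine norm_fderiv_le_of_lip' ℝ h.L_pos.le ?_
  filter_upwards [h.isOpen.mem_nhds hx] with y hy using h.grad_lip y hy x hx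

theorem coe_toReal (h : BasicAssumptions f g O L) {x : E n} (hx : x ∈ O) :
    ((f x).toReal : EReal) = f x :=
  EReal.coe_toReal (h.f_ne_top x hx) (h.f_ne_bot x)

theorem norm_Q_apply_le (h : BasicAssumptions f g O L) {γ : ℝ} (hγ : 0 < γ) {x : E n}
    (hx : x ∈ O) (w : E n) : ‖Q f γ x w‖ ≤ (1 + γ * L) * ‖w‖ := by
  have h1 : ‖hess f x w‖ ≤ L * ‖w‖ := (hess f x).le_of_opNorm_le (h.norm_hess_le hx) w
  simp only [Q, _root_.sub_apply, _root_.smul_apply,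
    ContinuousLinearMap.id_apply]
  calc _ ≤ ‖w‖ + ‖γ • hess f x w‖ := norm_sub_le _ _
    _ ≤ ‖w‖ + γ * (L * ‖w‖) := by rw [norm_smul, Real.norm_of_nonneg hγ.le]; gcongr
    _ = _ := by ring

theorem le_norm_Q_apply (h : BasicAssumptions f g O L) {γ : ℝ} (hγ : 0 < γ) {x : E n}
    (hx : x ∈ O) (w : E n) : (1 - γ * L) * ‖w‖ ≤ ‖Q f γ x w‖ := by
  have h1 : ‖hess f x w‖ ≤ L * ‖w‖ := (hess f x).le_of_opNorm_le (h.norm_hess_le hx) w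
  simp only [Q, _root_.sub_apply, _root_.smul_apply,
    ContinuousLinearMap.id_apply]
  calc (1 - γ * L) * ‖w‖ = ‖w‖ - γ * (L * ‖w‖) := by ring
    _ ≤ ‖w‖ - ‖γ • hess f x w‖ := by rw [norm_smul, Real.norm_of_nonneg hγ.le]; gcongr
    _ ≤ _ := norm_sub_norm_le _ _

theorem Q_symm (h : BasicAssumptions f g O L) (γ : ℝ) {x : E n} (hx : x ∈ O) (v w : E n) :
    inner ℝ (Q f γ x v) w = inner ℝ v (Q f γ x w) := by
  simp only [Q, _root_.sub_apply, _root_.smul_apply,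
    ContinuousLinearMap.id_apply, inner_sub_left, inner_sub_right, real_inner_smul_left,
    real_inner_smul_right, h.hess_symm hx]

theorem hasStrictFDerivAt_forward (h : BasicAssumptions f g O L) (γ : ℝ) {x : E n} (hx : x ∈ O) :
    HasStrictFDerivAt (fun u => u - γ • grad f u) (Q f γ x) x := by
  have hcont : ContinuousAt (hess f) x := by
    obtain ⟨K, hK⟩ := h.hess_lip
    have hK' : ∀ y ∈ O, ‖hess f y - hess f x‖ ≤ |K| * ‖y - x‖ := fun y hy =>
      (hK y hy x hx).trans (by gcongr; exact le_abs_self K)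
    rw [ContinuousAt, tendsto_iff_norm_sub_tendsto_zero]
    refine squeeze_zero' (Eventually.of_forall fun _ => norm_nonneg _)
      (by filter_upwards [h.isOpen.mem_nhds hx] with y hy using hK' y hy) ?_
    have : Tendsto (fun y => |K| * ‖y - x‖) (𝓝 x) (𝓝 (|K| * ‖x - x‖)) :=
      (Continuous.tendsto (by fun_prop) x)
    simpa using this
  have hg : HasStrictFDerivAt (grad f) (hess f x) x :=
    hasStrictFDerivAt_of_hasFDerivAt_of_continuousAt
      (by filter_upwards [h.isOpen.mem_nhds hx] with y hy using (h.grad_diff y hy).hasFDerivAt)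
      hcont
  exact (hasStrictFDerivAt_id x).sub (hg.const_smul γ)

theorem tendsto_Q (h : BasicAssumptions f g O L) (γ : ℝ) {x : E n} (hx : x ∈ O) :
    Tendsto (Q f γ) (𝓝 x) (𝓝 (Q f γ x)) := by
  obtain ⟨K, hK⟩ := h.hess_lip
  rw [tendsto_iff_norm_sub_tendsto_zero]
  have hK' : ∀ y ∈ O, ‖Q f γ y - Q f γ x‖ ≤ |γ| * (|K| * ‖y - x‖) := fun y hy => by
    have : Q f γ y - Q f γ x = -(γ • (hess f y - hess f x)) := by
      simp only [Q, smul_sub]; abel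
    rw [this, norm_neg, norm_smul, Real.norm_eq_abs]
    gcongr
    exact (hK y hy x hx).trans (by gcongr; exact le_abs_self K)
  refine squeeze_zero' (Eventually.of_forall fun _ => norm_nonneg _)
    (by filter_upwards [h.isOpen.mem_nhds hx] with y hy using hK' y hy) ?_
  have : Tendsto (fun y => |γ| * (|K| * ‖y - x‖)) (𝓝 x) (𝓝 (|γ| * (|K| * ‖x - x‖))) :=
    (Continuous.tendsto (by fun_prop) x)
  simpa using this

end BasicAssumptions

end Smooth

/-! ### Two-sided bounds for the forward-backward envelope. -/

section Envelope

variable {f g : E n → EReal} {O : Set (E n)} {L γ : ℝ}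

theorem ne_top_of_mem_prox (hg : Proper g) {u z : E n} (hz : z ∈ prox γ g u) : g z ≠ ⊤ := by
  obtain ⟨w, hw⟩ := hg.2
  intro htop
  have h1 := hz w
  have h2 : proxObj γ g u z = ⊤ := by
    simp only [proxObj, htop]; exact EReal.coe_add_top _
  rw [h2, top_le_iff] at h1
  exact (EReal.add_lt_top (EReal.coe_ne_top _) hw).ne h1

theorem proxObj_coe (hg : Proper g) {u z : E n} (hz : g z ≠ ⊤) (γ : ℝ) :
    proxObj γ g u z = (((2 * γ)⁻¹ * ‖z - u‖ ^ 2 + (g z).toReal : ℝ) : EReal) := by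
  rw [proxObj, EReal.coe_add, EReal.coe_toReal hz (hg.1 z)]

theorem BasicAssumptions.mem_of_mem_fbStep (h : BasicAssumptions f g O L) {x z : E n}
    (hz : z ∈ fbStep f g γ x) : z ∈ O :=
  h.dom_subset (lt_top_iff_ne_top.2 (ne_top_of_mem_prox h.g_proper hz))

theorem mem_zeroSet_iff (hγ : 0 < γ) {x : E n} : x ∈ zeroSet f g γ ↔ x ∈ fbStep f g γ x := by
  constructor
  · rintro ⟨z, hz, h0⟩
    have h1 : x - z = 0 := (smul_eq_zero.1 h0).resolve_left (inv_ne_zero hγ.ne')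
    rwa [← sub_eq_zero.1 h1] at hz
  · intro h
    exact ⟨x, h, by simp⟩

theorem fbe_eq_of_mem_fbStep (hγ : 0 < γ) {x z : E n} (hz : z ∈ fbStep f g γ x) :
    fbe f g γ x = (((f x).toReal + inner ℝ (grad f x) (z - x) + (2 * γ)⁻¹ * ‖z - x‖ ^ 2 : ℝ) :
      EReal) + g z := by
  have key : ∀ w, (((f x).toReal + inner ℝ (grad f x) (w - x) + (2 * γ)⁻¹ * ‖w - x‖ ^ 2 : ℝ) :
      EReal) + g w = (((f x).toReal - γ / 2 * ‖grad f x‖ ^ 2 : ℝ) : EReal) +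
        proxObj γ g (x - γ • grad f x) w := by
    intro w
    rw [proxObj, ← add_assoc, ← EReal.coe_add]
    congr 2
    have : w - (x - γ • grad f x) = (w - x) + γ • grad f x := by abel
    rw [this, norm_add_sq_real, norm_smul, Real.norm_of_nonneg hγ.le, real_inner_smul_right,
      real_inner_comm]
    field_simp
    ring
  refine le_antisymm (iInf_le _ z) (le_iInf fun w => ?_)
  rw [key, key]
  exact add_le_add_right (hz w) _

theorem fbe_antitone {γ₁ γ₂ : ℝ} (h1 : 0 < γ₁) (h12 : γ₁ ≤ γ₂) (x : E n) :
    fbe f g γ₂ x ≤ fbe f g γ₁ x := by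
  refine iInf_mono fun z => add_le_add_left (EReal.coe_le_coe_iff.2 ?_) _
  gcongr

theorem fbe_eq_objective (h : BasicAssumptions f g O L) (hγ : 0 < γ) {x : E n}
    (hx : x ∈ zeroSet f g γ) : fbe f g γ x = objective f g x := by
  rw [mem_zeroSet_iff hγ] at hx
  rw [fbe_eq_of_mem_fbStep hγ hx, objective, ← h.coe_toReal (h.mem_of_mem_fbStep hx)]
  simp

/-- Any z is a test point in the infimum, and replacing the linearization of f by f(z) costs at most
(L/2)‖z - x‖². -/
theorem fbe_le_objective_add (h : BasicAssumptions f g O L) {B : Set (E n)}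
    (hB : Convex ℝ B) (hBO : B ⊆ O) {x z : E n} (hx : x ∈ B) (hz : z ∈ B) :
    fbe f g γ x ≤ objective f g z + ((((2 * γ)⁻¹ + L / 2) * ‖z - x‖ ^ 2 : ℝ) : EReal) := by
  refine (iInf_le _ z).trans ?_
  rw [objective, ← h.coe_toReal (hBO hz), add_right_comm (_ : EReal) (g z), ← EReal.coe_add]
  refine add_le_add_left (EReal.coe_le_coe_iff.2 ?_) _
  have := (abs_le.1 (quadratic_bound_of_lipschitz_gradient hB
    (fun y hy => h.hasGradientAt (hBO hy))
    (fun u hu v hv => h.grad_lip u (hBO hu) v (hBO hv)) hx hz)).1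
  linarith

/-- At a minimizer the infimum is attained, so the same quadratic bound applies in the other
direction. -/
theorem objective_add_le_fbe (h : BasicAssumptions f g O L) (hγ : 0 < γ) {B : Set (E n)}
    (hB : Convex ℝ B) (hBO : B ⊆ O) {x z : E n} (hx : x ∈ B) (hz : z ∈ B)
    (hzx : z ∈ fbStep f g γ x) :
    objective f g z + ((((2 * γ)⁻¹ - L / 2) * ‖z - x‖ ^ 2 : ℝ) : EReal) ≤ fbe f g γ x := by
  rw [fbe_eq_of_mem_fbStep hγ hzx, objective, ← h.coe_toReal (hBO hz),
    add_right_comm (_ : EReal) (g z), ← EReal.coe_add]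
  refine add_le_add_left (EReal.coe_le_coe_iff.2 ?_) _
  have := (abs_le.1 (quadratic_bound_of_lipschitz_gradient hB
    (fun y hy => h.hasGradientAt (hBO hy))
    (fun u hu v hv => h.grad_lip u (hBO hu) v (hBO hv)) hx hz)).2
  linarith

end Envelope

/-! ### Symmetry and factorization of the generalized Hessian. -/

section GeneralizedHessian

variable {f g : E n → EReal} {O : Set (E n)} {L γ : ℝ}

theorem LocSingleLip.eventually {S : E n → Set (E n)} {x : E n} (h : LocSingleLip S x) :
    ∀ᶠ u in 𝓝 x, LocSingleLip S u := by
  obtain ⟨r, K, hr, h1, h2⟩ := h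
  filter_upwards [Metric.ball_mem_nhds x hr] with u hu
  obtain ⟨s, hs, hsub⟩ := Metric.isOpen_ball.mem_nhds hu |> Metric.mem_nhds_iff.1
  exact ⟨s, K, hs, fun v hv => h1 v (hsub hv), fun v hv w hw => h2 v (hsub hv) w (hsub hw)⟩

theorem LocSingleLip.eventually_existsUnique {S : E n → Set (E n)} {x : E n}
    (h : LocSingleLip S x) : ∀ᶠ u in 𝓝 x, ∃! z, z ∈ S u := by
  obtain ⟨r, K, hr, h1, h2⟩ := h
  filter_upwards [Metric.ball_mem_nhds x hr] with u hu using h1 u hu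

/-- Where it is single-valued and Lipschitz, the proximal mapping is a gradient. -/
theorem hasGradientAt_prox (hg : Proper g) (hγ : 0 < γ) {u : E n}
    (h : LocSingleLip (prox γ g) u) :
    HasGradientAt (fun w => inner ℝ (val (prox γ g) w) w - 1 / 2 * ‖val (prox γ g) w‖ ^ 2
      - γ * (g (val (prox γ g) w)).toReal) (val (prox γ g) u) u := by
  obtain ⟨r, K, hr, h1, h2⟩ := h
  set P := val (prox γ g) with hP
  set ψ : E n → ℝ := fun w => inner ℝ (P w) w - 1 / 2 * ‖P w‖ ^ 2 - γ * (g (P w)).toReal with hψ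
  have hmem : ∀ w ∈ Metric.ball u r, P w ∈ prox γ g w := fun w hw => val_mem (h1 w hw)
  -- `ψ w` is the supremum over z of ⟨z, w⟩ - ½‖z‖² - γ g(z), attained at `P w`; hence `P w` is a
  -- subgradient of `ψ`.
  have hsub : ∀ w ∈ Metric.ball u r, ∀ v ∈ Metric.ball u r,
      ψ w + inner ℝ (P w) (v - w) ≤ ψ v := by
    intro w hw v hv
    have hw' := ne_top_of_mem_prox hg (hmem w hw)
    have hv' := ne_top_of_mem_prox hg (hmem v hv)
    have h3 := hmem v hv (P w)
    rw [proxObj_coe hg hw', proxObj_coe hg hv', EReal.coe_le_coe_iff, norm_sub_sq_real,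
      norm_sub_sq_real] at h3
    have h4 := mul_le_mul_of_nonneg_left h3 hγ.le
    have h5 : ∀ a b : ℝ, γ * ((2 * γ)⁻¹ * a + b) = 1 / 2 * a + γ * b := by
      intro a b; field_simp
    rw [h5, h5] at h4
    simp only [hψ, inner_sub_right]
    linarith
  rw [hasGradientAt_iff_isLittleO]
  -- The subgradient inequalities at u and at w squeeze the remainder between 0 and ⟨P w - P u, w -
  -- u⟩, which is quadratic because `P` is Lipschitz.
  have hO : (fun w => ψ w - ψ u - inner ℝ (P u) (w - u)) =O[𝓝 u] fun w => ‖w - u‖ ^ 2 := by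
    refine Asymptotics.IsBigO.of_bound K ?_
    filter_upwards [Metric.ball_mem_nhds u hr] with w hw
    have hu := Metric.mem_ball_self (x := u) hr
    have h3 := hsub u hu w hw
    have h4 := hsub w hw u hu
    have h5 : inner ℝ (P w - P u) (w - u) ≤ K * ‖w - u‖ * ‖w - u‖ :=
      (real_inner_le_norm _ _).trans (mul_le_mul_of_nonneg_right
        (h2 w hw u hu _ (hmem w hw) _ (hmem u hu)) (norm_nonneg _))
    rw [inner_sub_left] at h5
    have h6 : inner ℝ (P w) (u - w) = -inner ℝ (P w) (w - u) := by
      rw [← neg_sub, inner_neg_right]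
    rw [Real.norm_eq_abs, abs_le, norm_pow, norm_norm]
    constructor <;> nlinarith
  refine hO.trans_isLittleO ?_
  exact (Asymptotics.isLittleO_norm_pow_id (E' := E n) one_lt_two).comp_tendsto
    (k := fun w => w - u) (l' := 𝓝 u) (by simpa using (tendsto_id (x := 𝓝 u)).sub_const u)

/-- Jacobians of a gradient map are symmetric, and symmetry survives limits and convex combinations.
-/
theorem clarke_prox_symm (hg : Proper g) (hγ : 0 < γ) {u : E n}
    (h : LocSingleLip (prox γ g) u) {W : E n →L[ℝ] E n} (hW : W ∈ clarke (val (prox γ g)) u)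
    (v w : E n) : inner ℝ (W v) w = inner ℝ v (W w) := by
  have hconv : Convex ℝ {W : E n →L[ℝ] E n | inner ℝ (W v) w = inner ℝ v (W w)} := by
    intro A hA B hB a b _ _ _
    simp only [Set.mem_ofPred_eq] at hA hB ⊢
    simp [inner_add_left, inner_add_right, real_inner_smul_left, real_inner_smul_right, hA, hB]
  refine convexHull_min ?_ hconv hW
  rintro V ⟨s, D, hs, hD, hDV⟩
  have h1 : Tendsto (fun j => inner ℝ (D j v) w) atTop (𝓝 (inner ℝ (V v) w)) :=
    ((ContinuousLinearMap.apply ℝ _ v).continuous.tendsto V |>.comp hDV).inner tendsto_const_nhds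
  have h2 : Tendsto (fun j => inner ℝ v (D j w)) atTop (𝓝 (inner ℝ v (V w))) :=
    tendsto_const_nhds.inner ((ContinuousLinearMap.apply ℝ _ w).continuous.tendsto V |>.comp hDV)
  refine tendsto_nhds_unique_of_eventuallyEq h1 h2 ?_
  filter_upwards [hs.eventually h.eventually] with j hj
  exact inner_deriv_symm_of_hasGradientAt (hj.eventually.mono fun y hy =>
    hasGradientAt_prox hg hγ hy) (hD j) v w

theorem genHess_symm (h : BasicAssumptions f g O L) (hγ : 0 < γ) {x : E n} (hx : x ∈ O)
    {H : E n →L[ℝ] E n} (hH : H ∈ genHess f g γ x) (v w : E n) :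
    inner ℝ (H v) w = inner ℝ v (H w) := by
  obtain ⟨hl, -, W, hW, rfl⟩ := hH
  simp only [_root_.smul_apply, ContinuousLinearMap.comp_apply,
    _root_.sub_apply, ContinuousLinearMap.id_apply, real_inner_smul_left,
    real_inner_smul_right, h.Q_symm γ hx, inner_sub_left, inner_sub_right, map_sub,
    clarke_prox_symm h.g_proper hγ hl hW]

/-- The generalized Hessian is `Q` composed with an element of the Clarke Jacobian of the
residual. -/
theorem exists_clarke_residual_of_mem_genHess (h : BasicAssumptions f g O L)
    {x : E n} (hx : x ∈ O) {H : E n →L[ℝ] E n} (hH : H ∈ genHess f g γ x) :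
    ∃ J ∈ clarke (val (residual f g γ)) x, H = Q f γ x ∘L J := by
  obtain ⟨hl, ⟨q, hq⟩, W, hW, rfl⟩ := hH
  set Φ : (E n →L[ℝ] E n) → (E n →L[ℝ] E n) := fun W =>
    γ⁻¹ • (ContinuousLinearMap.id ℝ (E n) - W ∘L Q f γ x) with hΦ
  refine ⟨Φ W, ?_, by simp [hΦ]⟩
  -- `Φ` is affine, so it suffices to treat limits of Jacobians.
  have hconv : Convex ℝ {W : E n →L[ℝ] E n | Φ W ∈ clarke (val (residual f g γ)) x} := by
    intro A hA B hB a b ha hb hab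
    have : Φ (a • A + b • B) = a • Φ A + b • Φ B := by
      ext1 v
      simp only [hΦ, _root_.smul_apply, ContinuousLinearMap.comp_apply,
        _root_.sub_apply, _root_.add_apply,
        ContinuousLinearMap.id_apply]
      obtain rfl : b = 1 - a := by linarith
      module
    simp only [Set.mem_ofPred_eq, this]
    exact convex_convexHull ℝ _ hA hB ha hb hab
  refine convexHull_min ?_ hconv hW
  rintro V ⟨s, D, hs, hD, hDV⟩
  refine subset_convexHull ℝ _ ?_
  have hst := h.hasStrictFDerivAt_forward γ hx
  have hst' : HasStrictFDerivAt (fun u => u - γ • grad f u)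
      ((ContinuousLinearEquiv.ofUnit q : E n ≃L[ℝ] E n) : E n →L[ℝ] E n) x := by
    have : ((ContinuousLinearEquiv.ofUnit q : E n ≃L[ℝ] E n) : E n →L[ℝ] E n) = Q f γ x := by
      rw [← hq]; rfl
    rwa [this]
  -- Differentiability points of the proximal map must be pulled back to differentiability points of
  -- the residual. Nonsingularity of Q makes the forward map locally invertible, and the chain rule
  -- applies at the preimages.
  set ψ := hst'.localInverse
  have hψ : Tendsto (fun j => ψ (s j)) atTop (𝓝 x) := hst'.localInverse_tendsto.comp hs
  have hO : ∀ᶠ y in 𝓝 x, y ∈ O := h.isOpen.mem_nhds hx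
  have hcont : Tendsto (fun u => u - γ • grad f u) (𝓝 x) (𝓝 (x - γ • grad f x)) :=
    hst.continuousAt
  have hev : ∀ᶠ y in 𝓝 x, val (residual f g γ) y
      = γ⁻¹ • (y - val (prox γ g) (y - γ • grad f y)) := by
    filter_upwards [hcont.eventually hl.eventually_existsUnique] with y hy
    rw [val_residual hy]
    rfl
  have hdiff : ∀ᶠ j in atTop, HasFDerivAt (val (residual f g γ))
      (γ⁻¹ • (ContinuousLinearMap.id ℝ (E n) - D j ∘L Q f γ (ψ (s j)))) (ψ (s j)) := by
    filter_upwards [hψ.eventually hev.eventually_nhds, hψ.eventually hO,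
      hs.eventually hst'.eventually_right_inverse] with j h1 h2 h3
    have h4 : HasFDerivAt (fun u => u - γ • grad f u) (Q f γ (ψ (s j))) (ψ (s j)) :=
      (h.hasStrictFDerivAt_forward γ h2).hasFDerivAt
    have h5 : HasFDerivAt (val (prox γ g)) (D j) (ψ (s j) - γ • grad f (ψ (s j))) := by
      have : ψ (s j) - γ • grad f (ψ (s j)) = s j := h3
      rw [this]; exact hD j
    have h6 := ((hasFDerivAt_id (ψ (s j))).sub
      (HasFDerivAt.comp (ψ (s j)) (f := fun u => u - γ • grad f u) h5 h4)).const_smul γ⁻¹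
    exact h6.congr_of_eventuallyEq h1
  obtain ⟨N, hN⟩ := eventually_atTop.1 hdiff
  refine ⟨fun j => ψ (s (j + N)), fun j => γ⁻¹ • (ContinuousLinearMap.id ℝ (E n) -
    D (j + N) ∘L Q f γ (ψ (s (j + N)))), hψ.comp (tendsto_add_atTop_nat N),
    fun j => hN _ (Nat.le_add_left _ _), ?_⟩
  have h1 := (h.tendsto_Q γ hx).comp hψ
  have h2 : Tendsto (fun j => γ⁻¹ • (ContinuousLinearMap.id ℝ (E n) -
      D j ∘L Q f γ (ψ (s j)))) atTop (𝓝 (Φ V)) :=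
    (tendsto_const_nhds.sub ((isBoundedBilinearMap_comp.continuous.tendsto (V, Q f γ x)).comp
      (hDV.prodMk_nhds h1))).const_smul γ⁻¹
  exact h2.comp (tendsto_add_atTop_nat N)

end GeneralizedHessian

/-! ### The regularized Newton equation. -/

section NewtonStep

/-- A minimizer of a strongly convex quadratic model over a large enough ball solves the Newton
equation and is close to any approximate solution. -/
theorem newton_step {H M J : E n →L[ℝ] E n} {a C η ρ : ℝ} (ha : 0 < a)
    (hHsymm : ∀ v w, inner ℝ (H v) w = inner ℝ v (H w))
    (hHpos : ∀ w, -(a / 2 * ‖w‖ ^ 2) ≤ inner ℝ w (H w)) (hHJ : H = M ∘L J)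
    (hM : ∀ w, ‖M w‖ ≤ C * ‖w‖) (hC : 0 ≤ C) {R v d : E n} (hη : ‖R + J v‖ ≤ η)
    (hρ : 2 / a * (C * η) + 3 * ‖v‖ ≤ ρ)
    (hmin : ∀ e, ‖e‖ ≤ ρ → quadModel H a (M R) d ≤ quadModel H a (M R) e) :
    M (R + J d) = -(a • d) ∧ ‖d‖ ≤ 2 / a * (C * η) + 3 * ‖v‖ := by
  have hpos : ∀ w, a / 2 * ‖w‖ ^ 2 ≤ inner ℝ w (H w + a • w) := fun w => by
    have := hHpos w
    rw [inner_add_right, real_inner_smul_right, real_inner_self_eq_norm_sq]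
    linarith
  have hlow : ∀ w, ‖w‖ ≤ 2 / a * ‖H w + a • w‖ := fun w => by
    rcases eq_or_lt_of_le (norm_nonneg w) with h0 | h0
    · rw [← h0]; positivity
    · have h1 := (hpos w).trans (real_inner_le_norm _ _)
      have h2 : a / 2 * ‖w‖ ≤ ‖H w + a • w‖ := by
        refine le_of_mul_le_mul_left ?_ h0
        linarith [h1]
      calc ‖w‖ = 2 / a * (a / 2 * ‖w‖) := by field_simp
        _ ≤ _ := by gcongr
  let A : E n →ₗ[ℝ] E n := (H + a • ContinuousLinearMap.id ℝ (E n) : E n →L[ℝ] E n)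
  have hA : ∀ w, A w = H w + a • w := fun w => by simp [A]
  have hinj : Function.Injective A := by
    rw [← LinearMap.ker_eq_bot, LinearMap.ker_eq_bot']
    intro w hw
    have h1 := hlow w
    rw [← hA, hw, norm_zero, mul_zero] at h1
    exact norm_le_zero_iff.1 h1
  obtain ⟨e, he⟩ := LinearMap.injective_iff_surjective.1 hinj (-(M R))
  rw [hA] at he
  -- The approximate solution `v` misses the equation by M(R + Jv) + a v, and the inverse of H + aI
  -- has norm at most 2/a.
  have hdist : ‖e - v‖ ≤ 2 / a * (C * η) + 2 * ‖v‖ := by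
    have h1 : H (e - v) + a • (e - v) = -(M (R + J v)) - a • v := by
      have : H v = M (J v) := by rw [hHJ]; rfl
      rw [map_sub, smul_sub, map_add, ← this, neg_add, ← he]
      abel
    have h2 := hlow (e - v)
    rw [h1] at h2
    have h3 : ‖-(M (R + J v)) - a • v‖ ≤ C * η + a * ‖v‖ := by
      refine (norm_sub_le _ _).trans ?_
      rw [norm_neg, norm_smul, Real.norm_of_nonneg ha.le]
      have := (hM (R + J v)).trans (mul_le_mul_of_nonneg_left hη hC)
      gcongr
    calc _ ≤ 2 / a * (C * η + a * ‖v‖) := h2.trans (by gcongr)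
      _ = _ := by field_simp
  have hnorm : ‖e‖ ≤ 2 / a * (C * η) + 3 * ‖v‖ := by
    have := norm_add_le (e - v) v
    rw [sub_add_cancel] at this
    linarith
  have hq := hmin e (hnorm.trans hρ)
  -- The model exceeds its value at `e` by ½⟨d - e, (H + aI)(d - e)⟩, so a point doing no worse than
  -- `e` is `e`.
  have hde : d = e := by
    have hMR : M R = -(H e + a • e) := by rw [he, neg_neg]
    have h1 := hpos (d - e)
    simp only [quadModel, hMR, inner_add_right, inner_neg_left, inner_add_left,
      real_inner_smul_right, real_inner_smul_left] at hq
    simp only [map_sub, smul_sub, inner_add_right, inner_sub_left, inner_sub_right,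
      real_inner_smul_right] at h1
    have h2 := hHsymm e d
    have h3 := hHsymm e e
    have h4 := real_inner_comm d (H e)
    have h5 := real_inner_comm e d
    have h6 : ‖d - e‖ ^ 2 ≤ 0 := by
      have : a / 2 * ‖d - e‖ ^ 2 ≤ 0 := by
        rw [h5] at h1
        linarith
      exact nonpos_of_mul_nonpos_right this (by positivity)
    have h7 : ‖d - e‖ = 0 := by nlinarith [norm_nonneg (d - e)]
    exact sub_eq_zero.1 (norm_eq_zero.1 h7)
  subst hde
  refine ⟨?_, hnorm⟩
  have : M (J d) = H d := by rw [hHJ]; rfl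
  rw [map_add, this, eq_neg_iff_add_eq_zero, add_assoc, he, add_neg_cancel]

end NewtonStep

/-! ### Local estimates around the limit point. -/

section Local

/-- The facts about the residual, the envelope and the objective that hold on a small ball around
the limit point. -/
structure LocalFacts (f g : E n → EReal) (O : Set (E n)) (L γ : ℝ) (xs : E n) (r K κ Fs : ℝ) :
    Prop where
  basic : BasicAssumptions f g O L
  γ_pos : 0 < γ
  γ_lt : γ * L < 1
  r_pos : 0 < r
  K_pos : 0 < K
  κ_pos : 0 < κ
  mem : xs ∈ zeroSet f g γ
  subset : Metric.ball xs r ⊆ O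
  unique : ∀ u ∈ Metric.ball xs r, ∃! z, z ∈ residual f g γ u
  lip : ∀ u ∈ Metric.ball xs r, ∀ v ∈ Metric.ball xs r,
    ‖val (residual f g γ) u - val (residual f g γ) v‖ ≤ K * ‖u - v‖
  errorBound : ∀ u ∈ Metric.ball xs r,
    Metric.infDist u (zeroSet f g γ) ≤ κ * ‖val (residual f g γ) u‖
  fbe_const : ∀ u ∈ Metric.ball xs r ∩ zeroSet f g γ, fbe f g γ u = (Fs : EReal)
  le_objective : ∀ u ∈ Metric.ball xs r, (Fs : EReal) ≤ objective f g u

theorem exists_localFacts {f g : E n → EReal} {O : Set (E n)} {L γ τ : ℝ} {xs : E n}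
    {x : ℕ → E n} (hb : BasicAssumptions f g O L) (hγ : 0 < γ) (hγL : γ * L < 1)
    (hloc : LocalAssumptions f g O γ x xs) (hC3 : CondC3 f g O γ τ xs) :
    ∃ r K κ Fs : ℝ, LocalFacts f g O L γ xs r K κ Fs := by
  have hxs := hloc.mem
  have hfix := (mem_zeroSet_iff hγ).1 hxs
  have hxO : xs ∈ O := hb.mem_of_mem_fbStep hfix
  obtain ⟨ε, κ, hε, hκ, herr, ε', hε', -, hconst⟩ := hloc.subregular
  obtain ⟨ε₂, κ₂, ρ₂, hε₂, -, -, -, h3⟩ := hC3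
  obtain ⟨⟨r₀, K, hr₀, huniq, hlip⟩, -⟩ := h3 xs ⟨Metric.mem_closedBall_self hε₂.le, hxO⟩
  obtain ⟨r₁, hr₁, hO⟩ := Metric.mem_nhds_iff.1 (hb.isOpen.mem_nhds hxO)
  obtain ⟨r₂, hr₂, hmin⟩ := Metric.mem_nhds_iff.1 hloc.localMin
  have hFs : ((objective f g xs).toReal : EReal) = objective f g xs := by
    have hg := ne_top_of_mem_prox hb.g_proper hfix
    rw [objective, ← hb.coe_toReal hxO, ← EReal.coe_toReal hg (hb.g_proper.1 xs), ← EReal.coe_add,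
      EReal.toReal_coe]
  set r := min (min r₀ (min r₁ r₂)) (min ε ε') with hr
  have hr0 : Metric.ball xs r ⊆ Metric.ball xs r₀ :=
    Metric.ball_subset_ball ((min_le_left _ _).trans (min_le_left _ _))
  have hr1 : Metric.ball xs r ⊆ Metric.ball xs r₁ :=
    Metric.ball_subset_ball ((min_le_left _ _).trans ((min_le_right _ _).trans (min_le_left _ _)))
  have hr2 : Metric.ball xs r ⊆ Metric.ball xs r₂ :=
    Metric.ball_subset_ball ((min_le_left _ _).trans ((min_le_right _ _).trans (min_le_right _ _)))
  have hrε : Metric.ball xs r ⊆ Metric.closedBall xs ε :=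
    Metric.ball_subset_closedBall.trans
      (Metric.closedBall_subset_closedBall ((min_le_right _ _).trans (min_le_left _ _)))
  have hrε' : Metric.ball xs r ⊆ Metric.closedBall xs ε' :=
    Metric.ball_subset_closedBall.trans
      (Metric.closedBall_subset_closedBall ((min_le_right _ _).trans (min_le_right _ _)))
  -- The Lipschitz constant supplied by (C3) has no sign, whence |K| + 1.
  refine ⟨r, |K| + 1, κ, (objective f g xs).toReal, hb, hγ, hγL, ?_, by positivity, hκ, hxs,
    hr1.trans hO, fun u hu => huniq u (hr0 hu), ?_, ?_, ?_, ?_⟩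
  · simp only [hr, lt_min_iff]; exact ⟨⟨hr₀, hr₁, hr₂⟩, hε, hε'⟩
  · intro u hu v hv
    refine (hlip u (hr0 hu) v (hr0 hv) _ (val_mem (huniq u (hr0 hu))) _
      (val_mem (huniq v (hr0 hv)))).trans ?_
    gcongr
    linarith [le_abs_self K]
  · intro u hu
    have h1 := herr u ⟨hrε hu, hO (hr1 hu)⟩
    rw [eq_singleton_val (huniq u (hr0 hu)), Metric.infEDist_singleton, edist_zero_left, ← enorm_eq_nnnorm,
      ← ofReal_norm, ← ENNReal.ofReal_mul hκ.le] at h1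
    exact ENNReal.toReal_le_of_le_ofReal (by positivity) h1
  · rintro u ⟨hu, hu'⟩
    rw [hFs, ← fbe_eq_objective hb hγ hxs]
    exact hconst u ⟨hrε' hu, hu'⟩
  · intro u hu
    rw [hFs]
    exact hmin (hr2 hu)

namespace LocalFacts

variable {f g : E n → EReal} {O : Set (E n)} {L γ : ℝ} {xs : E n} {r K κ Fs : ℝ}

theorem mem_ball_of_half (h : LocalFacts f g O L γ xs r K κ Fs) {u : E n}
    (hu : u ∈ Metric.ball xs (r / 2)) : u ∈ Metric.ball xs r :=
  Metric.ball_subset_ball (by linarith [h.r_pos]) hu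

theorem val_eq_zero (h : LocalFacts f g O L γ xs r K κ Fs) {u : E n} (hu : u ∈ Metric.ball xs r)
    (hz : u ∈ zeroSet f g γ) : val (residual f g γ) u = 0 :=
  val_eq_of_mem (h.unique u hu) hz

theorem mem_zeroSet_of_mem_closure (h : LocalFacts f g O L γ xs r K κ Fs) {u : E n}
    (hu : u ∈ Metric.ball xs r) (hc : u ∈ closure (zeroSet f g γ)) : u ∈ zeroSet f g γ := by
  have h0 : ‖val (residual f g γ) u‖ ≤ 0 := by
    refine le_of_forall_pos_le_add fun ε hε => ?_
    obtain ⟨s, hs, hsub⟩ := Metric.isOpen_ball.mem_nhds hu |> Metric.mem_nhds_iff.1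
    have hK := h.K_pos
    obtain ⟨z, hz, hzu⟩ := Metric.mem_closure_iff.1 hc (min s (ε / K)) (by positivity)
    have hzb : z ∈ Metric.ball xs r :=
      hsub (by rw [Metric.mem_ball, dist_comm]; exact hzu.trans_le (min_le_left _ _))
    have h1 := h.lip u hu z hzb
    rw [h.val_eq_zero hzb hz, sub_zero, ← dist_eq_norm] at h1
    calc _ ≤ K * dist u z := h1
      _ ≤ K * (ε / K) := by gcongr; exact hzu.le.trans (min_le_right _ _)
      _ = 0 + ε := by field_simp; ring
  have h1 := val_mem (h.unique u hu)
  rwa [norm_le_zero_iff.1 h0] at h1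

/-- Since `xs` lies in X*, a nearest point is at most twice as far from `xs` as u, hence the half
radius. It is taken in the closure of X*, and X* is closed relative to the ball. -/
theorem exists_projection (h : LocalFacts f g O L γ xs r K κ Fs) {u : E n}
    (hu : u ∈ Metric.ball xs (r / 2)) :
    ∃ ub ∈ projSet (zeroSet f g γ) u, ub ∈ Metric.ball xs r := by
  obtain ⟨ub, hub, hd⟩ := Metric.exists_mem_closure_infDist_eq_dist ⟨xs, h.mem⟩ u
  have h1 : dist u ub ≤ dist u xs := hd ▸ Metric.infDist_le_dist_of_mem h.mem
  have h2 : ub ∈ Metric.ball xs r := by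
    rw [Metric.mem_ball] at hu ⊢
    have := dist_triangle_left ub xs u
    linarith
  exact ⟨ub, ⟨h.mem_zeroSet_of_mem_closure h2 hub, by rw [hd, dist_eq_norm]⟩, h2⟩

theorem mem_zeroSet_of_infDist_eq_zero (h : LocalFacts f g O L γ xs r K κ Fs) {u : E n}
    (hu : u ∈ Metric.ball xs r) (h0 : Metric.infDist u (zeroSet f g γ) = 0) :
    u ∈ zeroSet f g γ :=
  h.mem_zeroSet_of_mem_closure hu ((Metric.mem_closure_iff_infDist_zero ⟨xs, h.mem⟩).2 h0)

theorem norm_residual_le (h : LocalFacts f g O L γ xs r K κ Fs) {u : E n}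
    (hu : u ∈ Metric.ball xs (r / 2)) :
    ‖val (residual f g γ) u‖ ≤ K * Metric.infDist u (zeroSet f g γ) := by
  obtain ⟨ub, ⟨hz, hd⟩, hb⟩ := h.exists_projection hu
  have := h.lip u (h.mem_ball_of_half hu) ub hb
  rwa [h.val_eq_zero hb hz, sub_zero, hd] at this

theorem fbe_le (h : LocalFacts f g O L γ xs r K κ Fs) {u : E n}
    (hu : u ∈ Metric.ball xs (r / 2)) :
    fbe f g γ u ≤ ((Fs + ((2 * γ)⁻¹ + L / 2) * Metric.infDist u (zeroSet f g γ) ^ 2 : ℝ) :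
      EReal) := by
  obtain ⟨ub, ⟨hz, hd⟩, hb⟩ := h.exists_projection hu
  have := fbe_le_objective_add (γ := γ) h.basic (convex_ball xs r) h.subset
    (h.mem_ball_of_half hu) hb
  rwa [← fbe_eq_objective h.basic h.γ_pos hz, h.fbe_const ub ⟨hb, hz⟩, norm_sub_rev, hd,
    ← EReal.coe_add] at this

/-- Local minimality bounds the objective at the forward-backward point below by `Fs`, and (1/(2γ) -
L/2)‖γR‖² is the quadratic term. -/
theorem le_fbe (h : LocalFacts f g O L γ xs r K κ Fs) {u : E n}
    (hu : u ∈ Metric.ball xs r) (hT : u - γ • val (residual f g γ) u ∈ Metric.ball xs r) :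
    ((Fs + (γ - γ ^ 2 * L) / 2 * ‖val (residual f g γ) u‖ ^ 2 : ℝ) : EReal) ≤ fbe f g γ u := by
  have hγ := h.γ_pos
  have hu1 := (existsUnique_residual_iff f g hγ u).1 (h.unique u hu)
  have hTe : u - γ • val (residual f g γ) u = val (fbStep f g γ) u := by
    rw [val_residual hu1, smul_smul, mul_inv_cancel₀ hγ.ne', one_smul, sub_sub_cancel]
  have h1 := objective_add_le_fbe h.basic hγ (convex_ball xs r) h.subset hu hT
    (hTe ▸ val_mem hu1)
  refine le_trans ?_ h1
  rw [EReal.coe_add]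
  refine add_le_add (h.le_objective _ hT) (EReal.coe_le_coe_iff.2 (le_of_eq ?_))
  rw [sub_sub_cancel_left, norm_neg, norm_smul, Real.norm_of_nonneg hγ.le]
  field_simp

theorem tendsto_infDist (h : LocalFacts f g O L γ xs r K κ Fs) :
    Tendsto (fun u => Metric.infDist u (zeroSet f g γ)) (𝓝 xs) (𝓝 0) := by
  have := (Metric.continuous_infDist_pt (zeroSet f g γ)).tendsto xs
  rwa [Metric.infDist_zero_of_mem h.mem] at this

theorem tendsto_const_mul_infDist_rpow (h : LocalFacts f g O L γ xs r K κ Fs) (C : ℝ) {q : ℝ}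
    (hq : 0 < q) :
    Tendsto (fun u => C * Metric.infDist u (zeroSet f g γ) ^ q) (𝓝 xs) (𝓝 0) := by
  have := (h.tendsto_infDist.rpow_const (p := q) (Or.inr hq.le)).const_mul C
  rwa [Real.zero_rpow hq.ne', mul_zero] at this

theorem tendsto_residual (h : LocalFacts f g O L γ xs r K κ Fs) :
    Tendsto (fun u => val (residual f g γ) u) (𝓝 xs) (𝓝 0) := by
  refine squeeze_zero_norm' ?_ (by simpa using h.tendsto_infDist.const_mul K)
  filter_upwards [Metric.ball_mem_nhds xs (half_pos h.r_pos)] with u hu using h.norm_residual_le hu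

/-- Estimates for the regularized Newton direction close to the solution set. -/
theorem newton_direction (h : LocalFacts f g O L γ xs r K κ Fs) {τ ϱ ςlo σlo σhi : ℝ}
    (hτ : 0 < τ) (hϱ0 : 0 < ϱ) (hϱ : ϱ < 1) (hς : 0 < ςlo) (hσ : 0 < σlo) (hσ' : σlo ≤ σhi)
    (hC1 : CondC1 f g O γ τ xs) (hC2 : CondC2 f g γ xs) (hC3 : CondC3 f g O γ τ xs) :
    ∃ C : ℝ, 0 < C ∧ ∀ᶠ u in 𝓝 xs, 0 < Metric.infDist u (zeroSet f g γ) →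
      ∀ H ∈ genHess f g γ u, ∀ σ ∈ Set.Icc σlo σhi, ∀ ς, ςlo ≤ ς → ∀ d,
      (∀ e, ‖e‖ ≤ ς * ‖val (residual f g γ) u‖ ^ ϱ →
        quadModel H (‖val (residual f g γ) u‖ ^ τ * σ) (Q f γ u (val (residual f g γ) u)) d ≤
        quadModel H (‖val (residual f g γ) u‖ ^ τ * σ) (Q f γ u (val (residual f g γ) u)) e) →
      ‖val (residual f g γ) (u + d)‖ ≤ C * Metric.infDist u (zeroSet f g γ) ^ (1 + τ) := by
  obtain ⟨ε₁, κ₁, ρ₁, hε₁, hκ₁, hτρ₁, -, h1⟩ := hC1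
  obtain ⟨δ₂, hδ₂, h2⟩ := hC2
  obtain ⟨ε₂, κ₂, ρ₂, hε₂, hκ₂, hτρ₂, -, h3⟩ := hC3
  have hγ := h.γ_pos
  have hκ := h.κ_pos
  have hK := h.K_pos
  have hr := h.r_pos
  have hL := h.basic.L_pos
  have hγL := h.γ_lt
  have hσhi : 0 < σhi := hσ.trans_le hσ'
  -- Bounds ‖d‖/δ: the first term is (2/a)·2κ₂δ^τ with ‖Q‖ ≤ 2 and σlo δ^τ ≤ κ^τ a, the 3 comes from
  -- `newton_step`.
  set C₁ : ℝ := 4 * κ₂ * κ ^ τ / σlo + 3 with hC₁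
  have hC₁pos : 0 < C₁ := by positivity
  have h1γ : 0 < 1 - γ * L := by linarith
  -- The first summand is the semismoothness remainder at u + d, the second is a‖d‖ divided by the
  -- lower bound 1 - γL of Q.
  refine ⟨κ₂ * C₁ ^ (1 + ρ₂) + σhi * K ^ τ * C₁ / (1 - γ * L), by positivity, ?_⟩
  have hs1 := (h.tendsto_const_mul_infDist_rpow (κ₁ * κ ^ τ) (sub_pos.2 hτρ₁)).eventually
    (eventually_le_nhds (half_pos hσ))
  have hs2 := (h.tendsto_const_mul_infDist_rpow (C₁ * κ ^ ϱ) (sub_pos.2 hϱ)).eventually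
    (eventually_le_nhds hς)
  have hs3 := h.tendsto_infDist.eventually (eventually_le_nhds one_pos)
  have hs4 := (h.tendsto_const_mul_infDist_rpow C₁ one_pos).eventually
    (eventually_le_nhds (half_pos hε₂))
  have hs5 := (h.tendsto_const_mul_infDist_rpow C₁ one_pos).eventually
    (eventually_lt_nhds (half_pos hr))
  filter_upwards [hs1, hs2, hs3, hs4, hs5, Metric.ball_mem_nhds xs (half_pos hr),
    Metric.closedBall_mem_nhds xs hε₁, Metric.closedBall_mem_nhds xs (half_pos hε₂),
    Metric.ball_mem_nhds xs (half_pos hδ₂)] with u hu1 hu2 hu3 hu4 hu5 hur huε₁ huε₂ huδ₂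
  intro hδ H hH σ hσm ς hςm d hmin
  obtain ⟨ub, ⟨hubz, hubd⟩, hubr⟩ := h.exists_projection hur
  set δ := Metric.infDist u (zeroSet f g γ) with hδdef
  set R := val (residual f g γ) with hR
  have hur' := h.mem_ball_of_half hur
  have huO := h.subset hur'
  have herr : δ ≤ κ * ‖R u‖ := h.errorBound u hur'
  have hRle : ‖R u‖ ≤ K * δ := h.norm_residual_le hur
  have hdxs : dist u ub ≤ dist u xs := by
    rw [dist_eq_norm, hubd]; exact Metric.infDist_le_dist_of_mem h.mem
  have htri := dist_triangle_left ub xs u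
  have hRpos : 0 < ‖R u‖ := by
    by_contra! hcon
    nlinarith
  set a := ‖R u‖ ^ τ * σ with ha
  have hσpos : 0 < σ := hσ.trans_le hσm.1
  have hapos : 0 < a := by positivity
  have hδτ : 0 < δ ^ τ := by positivity
  have hale : δ ^ τ * σlo ≤ κ ^ τ * a := by
    have : δ ^ τ ≤ κ ^ τ * ‖R u‖ ^ τ := by
      rw [← Real.mul_rpow hκ.le hRpos.le]; gcongr
    calc δ ^ τ * σlo ≤ (κ ^ τ * ‖R u‖ ^ τ) * σ := by gcongr; exact hσm.1
      _ = _ := by rw [ha]; ring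
  obtain ⟨Hb, hHb, hHHb⟩ := h1 u ⟨huε₁, huO⟩ ub ⟨hubz, hubd⟩ H hH
  have hHbpos := h2 ub ⟨hubz, by
    rw [Metric.mem_closedBall]; rw [Metric.mem_ball] at huδ₂; linarith⟩ Hb hHb
  -- The strict inequality ρ₁ > τ enters here: δ^(ρ₁ - τ) tends to 0.
  have hκδ : κ₁ * δ ^ ρ₁ ≤ a / 2 := by
    have e1 : δ ^ ρ₁ = δ ^ τ * δ ^ (ρ₁ - τ) := by
      rw [← Real.rpow_add hδ]; congr 1; ring
    have hκτ : 0 < κ ^ τ := by positivity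
    have : κ ^ τ * (κ₁ * δ ^ ρ₁) ≤ κ ^ τ * (a / 2) := by
      calc κ ^ τ * (κ₁ * δ ^ ρ₁) = δ ^ τ * (κ₁ * κ ^ τ * δ ^ (ρ₁ - τ)) := by rw [e1]; ring
        _ ≤ δ ^ τ * (σlo / 2) := by gcongr
        _ ≤ _ := by linarith
    exact le_of_mul_le_mul_left this hκτ
  have hHpos : ∀ w, -(a / 2 * ‖w‖ ^ 2) ≤ inner ℝ w (H w) := by
    intro w
    have e1 : inner ℝ w (H w) = inner ℝ w (Hb w) + inner ℝ w ((H - Hb) w) := by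
      rw [← inner_add_right]; simp
    have e2 : |inner ℝ w ((H - Hb) w)| ≤ a / 2 * ‖w‖ ^ 2 := by
      refine (abs_real_inner_le_norm _ _).trans ?_
      have := (H - Hb).le_of_opNorm_le (hHHb.trans (hubd.symm ▸ hκδ)) w
      calc _ ≤ ‖w‖ * (a / 2 * ‖w‖) := by gcongr
        _ = _ := by ring
    have := (abs_le.1 e2).1
    have := hHbpos w
    linarith
  obtain ⟨J, hJ, hHJ⟩ := exists_clarke_residual_of_mem_genHess h.basic huO hH
  have huε₂' : u ∈ Metric.closedBall xs ε₂ :=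
    Metric.closedBall_subset_closedBall (by linarith) huε₂
  have hss := (h3 u ⟨huε₂', huO⟩).2
  have hηle : ∀ t : ℝ, 0 ≤ t → t ≤ C₁ * δ → κ₂ * t ^ (1 + ρ₂) ≤
      κ₂ * C₁ ^ (1 + ρ₂) * δ ^ (1 + τ) := by
    intro t ht ht'
    have : 0 ≤ 1 + ρ₂ := by linarith
    calc κ₂ * t ^ (1 + ρ₂) ≤ κ₂ * (C₁ * δ) ^ (1 + ρ₂) := by gcongr
      _ = κ₂ * C₁ ^ (1 + ρ₂) * δ ^ (1 + ρ₂) := by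
        rw [Real.mul_rpow hC₁pos.le hδ.le]; ring
      _ ≤ _ := mul_le_mul_of_nonneg_left
        (Real.rpow_le_rpow_of_exponent_ge hδ hu3 (by linarith)) (by positivity)
  have hη : ‖R u + J (ub - u)‖ ≤ κ₂ * δ ^ (1 + τ) := by
    have e1 := hss ub ⟨by
      rw [Metric.mem_closedBall] at huε₂ ⊢; linarith, h.subset hubr⟩ J hJ
    rw [hR, h.val_eq_zero hubr hubz, zero_sub, ← neg_add', norm_neg, norm_sub_rev ub u, hubd] at e1
    refine e1.trans (mul_le_mul_of_nonneg_left
        (Real.rpow_le_rpow_of_exponent_ge hδ hu3 (by linarith)) (by positivity))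
  have hbound : 2 / a * (2 * (κ₂ * δ ^ (1 + τ))) + 3 * ‖ub - u‖ ≤ C₁ * δ := by
    rw [norm_sub_rev, hubd, hC₁, add_mul]
    refine add_le_add_left ?_ _
    rw [Real.rpow_add hδ, Real.rpow_one]
    calc 2 / a * (2 * (κ₂ * (δ * δ ^ τ))) = 4 * κ₂ * δ / (a * σlo) * (δ ^ τ * σlo) := by
          field_simp; ring
      _ ≤ 4 * κ₂ * δ / (a * σlo) * (κ ^ τ * a) := by gcongr
      _ = _ := by field_simp
  -- The Newton step fits in the trust region because δ = δ^ϱ δ^(1-ϱ) and ϱ < 1.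
  have hrad : C₁ * δ ≤ ς * ‖R u‖ ^ ϱ := by
    have e1 : δ = δ ^ ϱ * δ ^ (1 - ϱ) := by
      rw [← Real.rpow_add hδ]; simp
    have e2 : δ ^ ϱ ≤ κ ^ ϱ * ‖R u‖ ^ ϱ := by
      rw [← Real.mul_rpow hκ.le hRpos.le]; gcongr
    calc C₁ * δ = C₁ * (δ ^ ϱ * δ ^ (1 - ϱ)) := by rw [← e1]
      _ ≤ C₁ * ((κ ^ ϱ * ‖R u‖ ^ ϱ) * δ ^ (1 - ϱ)) := by gcongr
      _ = (C₁ * κ ^ ϱ * δ ^ (1 - ϱ)) * ‖R u‖ ^ ϱ := by ring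
      _ ≤ ς * ‖R u‖ ^ ϱ := by gcongr; exact hu2.trans hςm
  obtain ⟨hMd, hdn⟩ := newton_step hapos (genHess_symm h.basic hγ huO hH) hHpos hHJ
    (fun w => (h.basic.norm_Q_apply_le hγ huO w).trans
      (mul_le_mul_of_nonneg_right (by linarith : 1 + γ * L ≤ 2) (norm_nonneg w)))
    zero_le_two hη (hbound.trans hrad) hmin
  have hdC : ‖d‖ ≤ C₁ * δ := hdn.trans hbound
  rw [Real.rpow_one] at hu4 hu5
  have hwd : dist (u + d) xs ≤ dist u xs + ‖d‖ := by
    have := dist_triangle (u + d) u xs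
    rw [dist_eq_norm (u + d) u, add_sub_cancel_left] at this
    linarith
  have hwr : u + d ∈ Metric.ball xs r := by
    rw [Metric.mem_ball] at hur ⊢; linarith
  have e1 := hss (u + d) ⟨by
    rw [Metric.mem_closedBall] at huε₂ ⊢; linarith, h.subset hwr⟩ J hJ
  rw [add_sub_cancel_left] at e1
  have e2 : ‖R u + J d‖ ≤ σhi * K ^ τ * C₁ / (1 - γ * L) * δ ^ (1 + τ) := by
    have e3 := h.basic.le_norm_Q_apply hγ huO (R u + J d)
    rw [hMd, norm_neg, norm_smul, Real.norm_of_nonneg hapos.le] at e3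
    have e4 : a * ‖d‖ ≤ ((K * δ) ^ τ * σhi) * (C₁ * δ) := by
      rw [ha]; gcongr; exact hσm.2
    rw [Real.mul_rpow hK.le hδ.le] at e4
    rw [div_mul_eq_mul_div, le_div_iff₀ h1γ, Real.rpow_add hδ, Real.rpow_one]
    linarith
  have e5 : R (u + d) = (R (u + d) - R u - J d) + (R u + J d) := by abel
  rw [e5, add_mul]
  exact (norm_add_le _ _).trans (add_le_add (e1.trans (hηle _ (norm_nonneg d) hdC)) e2)

/-- Superlinearly accurate trial points satisfy the sufficient decrease condition. -/
theorem eventually_sufficient_decrease (h : LocalFacts f g O L γ xs r K κ Fs) {τ c : ℝ}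
    (hτ : 0 < τ) :
    ∀ᶠ u in 𝓝 xs, ∀ w ∈ Metric.ball xs (r / 2),
      Metric.infDist w (zeroSet f g γ) ≤ c * Metric.infDist u (zeroSet f g γ) ^ (1 + τ) →
      fbe f g γ w ≤ fbe f g γ u -
        (((γ - γ ^ 2 * L) / 4 * ‖val (residual f g γ) u‖ ^ 2 : ℝ) : EReal) := by
  have hγ := h.γ_pos
  have hκ := h.κ_pos
  have hL := h.basic.L_pos
  have hA : 0 < γ - γ ^ 2 * L := by nlinarith [h.γ_lt]
  have hs1 := (h.tendsto_const_mul_infDist_rpow (((2 * γ)⁻¹ + L / 2) * c ^ 2 * κ ^ 2)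
    (q := 2 * τ) (by positivity)).eventually
    (eventually_le_nhds (by positivity : 0 < (γ - γ ^ 2 * L) / 4))
  have hT : Tendsto (fun u => u - γ • val (residual f g γ) u) (𝓝 xs) (𝓝 xs) := by
    simpa using tendsto_id.sub (h.tendsto_residual.const_smul γ)
  filter_upwards [hs1, Metric.ball_mem_nhds xs (half_pos h.r_pos),
    hT.eventually (Metric.ball_mem_nhds xs h.r_pos)] with u hu1 hur huT w hw hwd
  have hur' := h.mem_ball_of_half hur
  have herr := h.errorBound u hur'
  have hup := h.fbe_le hw
  have hlo := h.le_fbe hur' huT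
  set δ := Metric.infDist u (zeroSet f g γ)
  have hδ0 : 0 ≤ δ := Metric.infDist_nonneg
  rw [EReal.le_sub_iff_add_le (Or.inl (EReal.coe_ne_bot _)) (Or.inl (EReal.coe_ne_top _))]
  refine (add_le_add_left hup _).trans (le_trans ?_ hlo)
  rw [← EReal.coe_add, EReal.coe_le_coe_iff]
  have e1 : (δ ^ (1 + τ)) ^ 2 = δ ^ 2 * δ ^ (2 * τ) := by
    rw [Real.rpow_one_add' hδ0 (by positivity), mul_pow, mul_comm 2 τ, Real.rpow_mul hδ0]
    norm_num
  -- The lower bound `hlo` carries the factor 1/2 and the test only 1/4; the spare 1/4 absorbs the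
  -- higher-order error at w.
  have e2 : ((2 * γ)⁻¹ + L / 2) * Metric.infDist w (zeroSet f g γ) ^ 2 ≤
      (γ - γ ^ 2 * L) / 4 * ‖val (residual f g γ) u‖ ^ 2 := by
    calc _ ≤ ((2 * γ)⁻¹ + L / 2) * (c * δ ^ (1 + τ)) ^ 2 := by
          gcongr; exact Metric.infDist_nonneg
      _ = ((2 * γ)⁻¹ + L / 2) * c ^ 2 * δ ^ (2 * τ) * δ ^ 2 := by rw [mul_pow, e1]; ring
      _ ≤ ((2 * γ)⁻¹ + L / 2) * c ^ 2 * δ ^ (2 * τ) * (κ * ‖val (residual f g γ) u‖) ^ 2 := by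
          gcongr
      _ = ((2 * γ)⁻¹ + L / 2) * c ^ 2 * κ ^ 2 * δ ^ (2 * τ) * ‖val (residual f g γ) u‖ ^ 2 := by
          ring
      _ ≤ _ := by gcongr
  linarith

end LocalFacts

end Local

/-! ### Superlinear ratios and properties of a run. -/

theorem tendsto_div_of_le_const_mul_rpow {a b : ℕ → ℝ} {c τ : ℝ} (hτ : 0 < τ)
    (ha : ∀ k, 0 ≤ a k) (hb : Tendsto b atTop (𝓝 0)) (hpos : ∀ᶠ k in atTop, 0 < b k)
    (hab : ∀ᶠ k in atTop, a k ≤ c * b k ^ (1 + τ)) :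
    Tendsto (fun k => a k / b k) atTop (𝓝 0) := by
  have h1 : Tendsto (fun k => c * b k ^ τ) atTop (𝓝 0) := by
    have := (hb.rpow_const (p := τ) (Or.inr hτ.le)).const_mul c
    rwa [Real.zero_rpow hτ.ne', mul_zero] at this
  refine squeeze_zero' ?_ ?_ h1
  · filter_upwards [hpos] with k hk using div_nonneg (ha k) hk.le
  · filter_upwards [hpos, hab] with k hk hk'
    rw [div_le_iff₀ hk]
    rw [Real.rpow_add hk, Real.rpow_one] at hk'
    linarith

theorem Params.Admissible.γstar_pos {p : Params} {L : ℝ} (hp : p.Admissible L) (hL : 0 < L) :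
    0 < p.γstar L := by
  have := hp.α_pos
  rw [Params.γstar]; positivity

theorem Params.Admissible.γstar_mul_lt {p : Params} {L : ℝ} (hp : p.Admissible L) (hL : 0 < L) :
    p.γstar L * L < 1 := by
  have := hp.α_pos
  rw [Params.γstar, inv_mul_lt_iff₀ (by positivity)]; linarith

namespace IsRun

variable {f g : E n → EReal} {O : Set (E n)} {L : ℝ} {p : Params} {it : Iterates n} {xs : E n}
  {r K κ Fs : ℝ}

theorem γstar_le (hrun : IsRun f g O L p it) (hp : p.Admissible L) (hL : 0 < L) (k : ℕ) :
    p.γstar L ≤ it.γ k := by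
  have := hp.α_pos
  refine le_trans ?_ (hrun.γ_mem k).1
  rw [Params.γstar, one_div]
  gcongr
  linarith

theorem x_mem_domain (hrun : IsRun f g O L p it) (hb : BasicAssumptions f g O L) (k : ℕ) :
    it.x k ∈ O :=
  hb.mem_of_mem_fbStep (hrun.x_mem k)

/-- Close to the limit the initial proximal parameter is accepted. -/
theorem eventually_γt_eq (hrun : IsRun f g O L p it) (hp : p.Admissible L)
    (hb : BasicAssumptions f g O L) (hx : Tendsto it.x atTop (𝓝 xs))
    (hC3 : CondC3 f g O (p.γstar L) p.τ xs) :
    ∀ᶠ k in atTop, it.γt p L k = p.γstar L := by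
  obtain ⟨ε₂, κ₂, ρ₂, hε₂, -, -, -, h3⟩ := hC3
  filter_upwards [hx.eventually (Metric.closedBall_mem_nhds xs hε₂)] with k hk
  have h1 := ((h3 _ ⟨hk, hrun.x_mem_domain hb k⟩).1).fbStep_of_residual (hp.γstar_pos hb.L_pos)
  have h2 : it.m k ≤ 0 := (hrun.m_least k).2 (by simpa using h1)
  rw [Iterates.γt, Nat.le_zero.1 h2, pow_zero, mul_one]

/-- Local minimality at x^k, the descent test, and monotonicity of the envelope in γ (γ_k is at
least `p.γstar L`) are chained. This yields both that y^k avoids X* and that ‖x^k - y^k‖ is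
controlled by dist(y^k, X*). -/
theorem eventually_add_sq_le_fbe (hrun : IsRun f g O L p it) (hp : p.Admissible L)
    (h : LocalFacts f g O L (p.γstar L) xs r K κ Fs) (hx : Tendsto it.x atTop (𝓝 xs)) :
    ∀ᶠ k in atTop, ((Fs + p.α / 2 * ‖it.x k - it.y k‖ ^ 2 : ℝ) : EReal) ≤
      fbe f g (p.γstar L) (it.y k) := by
  filter_upwards [hx.eventually (Metric.ball_mem_nhds xs h.r_pos)] with k hk
  have h1 := (h.le_objective _ hk).trans (hrun.x_descent k)
  rw [EReal.le_sub_iff_add_le (Or.inl (EReal.coe_ne_bot _)) (Or.inl (EReal.coe_ne_top _)),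
    ← EReal.coe_add] at h1
  exact h1.trans (fbe_antitone h.γ_pos (hrun.γstar_le hp h.basic.L_pos k) _)

theorem eventually_not_fbe_y_le (hrun : IsRun f g O L p it) (hp : p.Admissible L)
    (h : LocalFacts f g O L (p.γstar L) xs r K κ Fs) (hx : Tendsto it.x atTop (𝓝 xs)) :
    ∀ᶠ k in atTop, ¬ fbe f g (p.γstar L) (it.y k) ≤ (Fs : EReal) := by
  filter_upwards [hrun.eventually_add_sq_le_fbe hp h hx] with k hk hle
  have h1 := EReal.coe_le_coe_iff.1 (hk.trans hle)
  have h2 : 0 < ‖it.x k - it.y k‖ := norm_pos_iff.2 (sub_ne_zero.2 (hrun.not_stop k))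
  have := hp.α_pos
  have : 0 < p.α / 2 * ‖it.x k - it.y k‖ ^ 2 := by positivity
  linarith

/-- If x^k were in X*, the acceptance test would force F_*(y^(k+1)) ≤ Fs, which x^(k+1) ≠ y^(k+1)
excludes. -/
theorem eventually_infDist_x_pos (hrun : IsRun f g O L p it) (hp : p.Admissible L)
    (h : LocalFacts f g O L (p.γstar L) xs r K κ Fs) (hx : Tendsto it.x atTop (𝓝 xs))
    (hγ : ∀ᶠ k in atTop, it.γt p L k = p.γstar L) :
    ∀ᶠ k in atTop, 0 < Metric.infDist (it.x k) (zeroSet f g (p.γstar L)) := by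
  filter_upwards [hx.eventually (Metric.ball_mem_nhds xs h.r_pos), hγ,
    (tendsto_add_atTop_nat 1).eventually (hrun.eventually_not_fbe_y_le hp h hx)] with k hk hγk hy
  refine Metric.infDist_nonneg.lt_of_ne' fun h0 => hy ?_
  have h1 := (hrun.l_least k).1.2
  rw [← hrun.y_succ k, hγk,
    h.fbe_const _ ⟨hk, h.mem_zeroSet_of_infDist_eq_zero hk h0⟩] at h1
  refine h1.trans ?_
  rw [← EReal.coe_sub, EReal.coe_le_coe_iff, sub_le_self_iff]
  have := h.γ_pos
  have := h.γ_lt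
  have : 0 ≤ p.γstar L - p.γstar L ^ 2 * L := by nlinarith
  positivity

end IsRun

end PGSSN

end

/-! ### Assembly of the convergence theorem. -/

open PGSSN in
theorem theorem5p1 {n : ℕ} (f g : PGSSN.E n → EReal) (O : Set (PGSSN.E n)) (L : ℝ)
    (p : PGSSN.Params) (it : PGSSN.Iterates n) (xs : PGSSN.E n)
    (hp : p.Admissible L)
    (hrun : PGSSN.IsRun f g O L p it)
    (h1 : PGSSN.BasicAssumptions f g O L)
    (h2 : PGSSN.ProxAssumptions g L)
    (h3 : Bornology.IsBounded (Set.range it.x))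
    (h4 : PGSSN.LocalAssumptions f g O (p.γstar L) it.x xs)
    (hC1 : PGSSN.CondC1 f g O (p.γstar L) p.τ xs)
    (hC2 : PGSSN.CondC2 f g (p.γstar L) xs)
    (hC3 : PGSSN.CondC3 f g O (p.γstar L) p.τ xs) :
    ∃ (c c' : ℝ) (K : ℕ), 0 < c ∧ 0 < c' ∧
      (∀ k > K, 0 < Metric.infDist (it.x k) (PGSSN.zeroSet f g (p.γstar L)) ∧
        Metric.infDist (it.x k + it.d k) (PGSSN.zeroSet f g (p.γstar L)) ≤
          c * Metric.infDist (it.x k) (PGSSN.zeroSet f g (p.γstar L)) ^ (1 + p.τ)) ∧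
      Tendsto (fun k => Metric.infDist (it.x k + it.d k) (PGSSN.zeroSet f g (p.γstar L)) /
        Metric.infDist (it.x k) (PGSSN.zeroSet f g (p.γstar L))) atTop (𝓝 0) ∧
      (∀ k > K, it.l k = 0) ∧
      Tendsto (fun k => Metric.infDist (it.y k) (PGSSN.zeroSet f g (p.γstar L))) atTop (𝓝 0) ∧
      (∀ k > K, 0 < Metric.infDist (it.y k) (PGSSN.zeroSet f g (p.γstar L)) ∧
        Metric.infDist (it.y (k + 1)) (PGSSN.zeroSet f g (p.γstar L)) ≤
          c' * Metric.infDist (it.y k) (PGSSN.zeroSet f g (p.γstar L)) ^ (1 + p.τ)) ∧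
      Tendsto (fun k => Metric.infDist (it.y (k + 1)) (PGSSN.zeroSet f g (p.γstar L)) /
        Metric.infDist (it.y k) (PGSSN.zeroSet f g (p.γstar L))) atTop (𝓝 0) := by
  have hx := h4.tendsto
  have hα := hp.α_pos
  have hτ := hp.τ_pos
  have hL := h1.L_pos
  obtain ⟨r, K, κ, Fs, hF⟩ := exists_localFacts h1 (hp.γstar_pos hL) (hp.γstar_mul_lt hL) h4 hC3
  have hγt := hrun.eventually_γt_eq hp h1 hx hC3
  have hxpos := hrun.eventually_infDist_x_pos hp hF hx hγt
  obtain ⟨C, hC, hnewton⟩ := hF.newton_direction hτ hp.ϱ_pos (by linarith [hp.ϱ_lt]) hp.ςlo_pos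
    hp.σlo_pos hp.σlo_lt.le hC1 hC2 hC3
  have hκ := hF.κ_pos
  set X := zeroSet f g (p.γstar L) with hX
  -- The trust radius alone suffices, since the residual vanishes in the limit and ϱ > 0. It places
  -- x^k + d^k in the ball before any rate is known.
  have hd : Tendsto it.d atTop (𝓝 0) := by
    have e1 := ((hF.tendsto_residual.comp hx).norm.rpow_const (p := p.ϱ)
      (Or.inr hp.ϱ_pos.le)).const_mul p.ςhi
    rw [norm_zero, Real.zero_rpow hp.ϱ_pos.ne', mul_zero] at e1
    refine squeeze_zero_norm' ?_ e1
    filter_upwards [hγt] with k hk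
    have e2 := hrun.d_mem k
    rw [Iterates.res, hk] at e2
    exact e2.trans (mul_le_mul_of_nonneg_right (hrun.ς_mem k).2 (by positivity))
  have hxd : Tendsto (fun k => it.x k + it.d k) atTop (𝓝 xs) := by simpa using hx.add hd
  have hstep : ∀ᶠ k in atTop, Metric.infDist (it.x k + it.d k) X ≤
      κ * C * Metric.infDist (it.x k) X ^ (1 + p.τ) := by
    filter_upwards [hγt, hxpos, hx.eventually hnewton,
      hxd.eventually (Metric.ball_mem_nhds xs hF.r_pos)] with k hk hpos hn hb
    have e1 := hrun.H_mem k
    have e2 := hrun.d_min k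
    simp only [Iterates.res, hk] at e1 e2
    have e3 := hn hpos _ e1 _ (hrun.σ_mem k) _ (hrun.ς_mem k).1 _ e2
    calc _ ≤ κ * ‖val (residual f g (p.γstar L)) (it.x k + it.d k)‖ := hF.errorBound _ hb
      _ ≤ κ * (C * Metric.infDist (it.x k) X ^ (1 + p.τ)) := by gcongr
      _ = _ := by ring
  have htrial : ∀ k, it.trial f g p L k 0 = it.x k + it.d k := fun k => by
    simp [Iterates.trial]
  have hl : ∀ᶠ k in atTop, it.l k = 0 := by
    filter_upwards [hγt, hstep, hx.eventually (hF.eventually_sufficient_decrease hτ),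
      hxd.eventually (Metric.ball_mem_nhds xs (half_pos hF.r_pos))] with k hk hs hdec hb
    refine Nat.le_zero.1 ((hrun.l_least k).2 ?_)
    rw [Set.mem_ofPred_eq, htrial, Iterates.res, hk]
    exact ⟨hF.subset (hF.mem_ball_of_half hb), hdec _ hb hs⟩
  have hysucc : ∀ᶠ k in atTop, it.y (k + 1) = it.x k + it.d k := by
    filter_upwards [hl] with k hk
    rw [hrun.y_succ, hk, htrial]
  have hy : Tendsto it.y atTop (𝓝 xs) :=
    (tendsto_add_atTop_iff_nat 1).1 (hxd.congr' (hysucc.mono fun k hk => hk.symm))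
  have hypos : ∀ᶠ k in atTop, 0 < Metric.infDist (it.y k) X := by
    filter_upwards [hy.eventually (Metric.ball_mem_nhds xs hF.r_pos),
      hrun.eventually_not_fbe_y_le hp hF hx] with k hk hne
    exact Metric.infDist_nonneg.lt_of_ne' fun h0 =>
      hne (hF.fbe_const _ ⟨hk, hF.mem_zeroSet_of_infDist_eq_zero hk h0⟩).le
  set A : ℝ := (2 * p.γstar L)⁻¹ + L / 2 with hA
  have hApos : 0 < A := by have := hF.γ_pos; positivity
  -- From (α/2)‖x^k - y^k‖² ≤ A dist(y^k, X*)² and the triangle inequality.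
  set D : ℝ := 1 + √(2 * A / p.α) with hD
  have hxy : ∀ᶠ k in atTop, Metric.infDist (it.x k) X ≤ D * Metric.infDist (it.y k) X := by
    filter_upwards [hrun.eventually_add_sq_le_fbe hp hF hx,
      hy.eventually (Metric.ball_mem_nhds xs (half_pos hF.r_pos))] with k hk hyk
    have e1 := EReal.coe_le_coe_iff.1 (hk.trans (hF.fbe_le hyk))
    rw [← hA, ← hX] at e1
    have e2 : ‖it.x k - it.y k‖ ≤ √(2 * A / p.α) * Metric.infDist (it.y k) X := by
      refine le_of_sq_le_sq ?_ (mul_nonneg (Real.sqrt_nonneg _) Metric.infDist_nonneg)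
      rw [mul_pow, Real.sq_sqrt (by positivity), div_mul_eq_mul_div, le_div_iff₀ hα]
      linarith
    have e3 := Metric.infDist_le_infDist_add_dist (s := X) (x := it.x k) (y := it.y k)
    rw [dist_eq_norm] at e3
    rw [hD, add_mul, one_mul]
    linarith
  have hDpos : 0 < D := by positivity
  have hystep : ∀ᶠ k in atTop, Metric.infDist (it.y (k + 1)) X ≤
      κ * C * D ^ (1 + p.τ) * Metric.infDist (it.y k) X ^ (1 + p.τ) := by
    filter_upwards [hysucc, hstep, hxy] with k e1 e2 e3
    rw [e1, mul_assoc (κ * C), ← Real.mul_rpow hDpos.le Metric.infDist_nonneg]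
    refine e2.trans ?_
    gcongr
    exact Metric.infDist_nonneg
  have hxlim := hF.tendsto_infDist.comp hx
  have hylim := hF.tendsto_infDist.comp hy
  obtain ⟨N, hN⟩ := eventually_atTop.1
    (hxpos.and (hstep.and (hl.and (hypos.and hystep))))
  refine ⟨κ * C, κ * C * D ^ (1 + p.τ), N, by positivity, by positivity,
    fun k hk => ⟨(hN k hk.le).1, (hN k hk.le).2.1⟩, ?_, fun k hk => (hN k hk.le).2.2.1, hylim,
    fun k hk => (hN k hk.le).2.2.2, ?_⟩
  · exact tendsto_div_of_le_const_mul_rpow hτ (fun _ => Metric.infDist_nonneg) hxlim hxpos hstep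
  · exact tendsto_div_of_le_const_mul_rpow hτ (fun _ => Metric.infDist_nonneg) hylim hypos hystep
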